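/- **Setting.** Consider a finite stochastic game with random stopping: finitely many players $i$, a finite state space $\mathcal S$, finite action sets $\mathcal A_i$ with $\mathcal A=\prod_i\mathcal A_i$, reward functions $r_i:\mathcal S\times\mathcal A\to[-1,1]$, transition probabilities $P(s'\mid s,a)\ge 0$ such that the stopping probability $1-\sum_{s'}P(s'\mid s,a)$ is positive for all $(s,a)$, and an initial distribution $\rho\in\Delta(\mathcal S)$. Let $\Pi=\prod_i\Delta(\mathcal A_i)^{\mathcal S}$ be the set of stationary Markovian policy profiles, a subset of a Euclidean space. For $\pi\in\Pi$ let $$V_{i,\rho}(\pi)=\mathbb E\Big[\sum_{t=0}^{T} r_i(s_t,a_t)\Big]=\sum_{\tau}\mathbb P^{\pi}(\tau)\sum_{t=0}^{T(\tau)} r_i(s_t,a_t)$$ be the value function of player $i$ (the expected total reward of an episode with $s_0\sim\rho$ that stops at the random time $T$; the sum is over the finite trajectories $\tau=(s_0,a_0,\dots,s_T,a_T)$). The right-hand series extends $V_{i,\rho}$ to a neighborhood of $\Pi$. Let $v(\pi)=(\nabla_{\pi_i}V_{i,\rho}(\pi))_i$ be the profile of individual policy gradients. A policy $\pi^*\in\Pi$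 is *Nash* if $V_{i,\rho}(\pi^*)\ge V_{i,\rho}(\pi_i;\pi^*_{-i})$ for all $i$ and all $\pi_i\in\Delta(\mathcal A_i)^{\mathcal S}$. A Nash policy $\pi^*$ is *stable* if $\langle v(\pi),\pi-\pi^*\rangle<0$ for all $\pi\in\Pi\setminus\{\pi^*\}$ sufficiently close to $\pi^*$. Given $\gamma>0$, $m\ge0$ and $p$, a *sequence of play of projected policy gradient* is a random sequence $\pi_1,\pi_2,\dots\in\Pi$ with $$\pi_{n+1}=\operatorname{proj}_{\Pi}\Big(\pi_n+\frac{\gamma}{(n+m)^p}\,\hat v_n\Big),\qquad n=1,2,\dots,$$ where $\operatorname{proj}_\Pi$ is the Euclidean projection and the $\hat v_n$ are square-integrable random vectors. With $\mathcal F_n=\sigma(\pi_1,\dots,\pi_n)$, let $b_n=\mathbb E[\hat v_n\mid\mathcal F_n]-v(\pi_n)$ be the bias and $U_n=\hat v_n-\mathbb E[\hat v_n\mid\mathcal F_n]$ the noise. For deterministic sequences $(B_n)$, $(\sigma_n)$, the gradient estimates have *error bounds* $(B_n,\sigma_n)$ if almost surely, for all $n\ge1$, $$\mathbb E[\|b_n\|\mid\mathcal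 F_n]\le B_n\quad\text{and}\quad \mathbb E[\|U_n\|^2\mid\mathcal F_n]\le\sigma_n^2 .$$ **Theorem.** Let $\pi^*$ be a stable Nash policy. Then there is a (measurable) neighborhood $\mathcal U$ of $\pi^*$ in $\Pi$ such that the following holds. Let $p\in(1/2,1]$, let $\ell_b,\ell_\sigma\in\mathbb R$ satisfy $p+\ell_b>1$ and $p-\ell_\sigma>1/2$, and let $B_n=O(n^{-\ell_b})$ and $\sigma_n=O(n^{\ell_\sigma})$ be deterministic sequences. Then, for every $\delta>0$, every sequence of play of projected policy gradient with step-size $\gamma/(n+m)^p$ and gradient estimates with error bounds $(B_n,\sigma_n)$, and such that $\mathbb P(\pi_1\in\mathcal U)>0$, satisfies $$\mathbb P\big(\pi_n\to\pi^*\text{ as }n\to\infty\,\big|\,\pi_1\in\mathcal U\big)\ \ge\ 1-\delta,$$ provided that $\gamma$ is small enough or $m$ is large enough. More precisely: (a) there is $\gamma_0>0$ such that this holds for all $0<\gamma\le\gamma_0$ and all $m\ge0$; and (b) for every $\gamma>0$ there is $m_0\ge0$ such that this holds for all $m\ge m_0$. -/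

import Mathlib

open MeasureTheory ProbabilityTheory Filter Topology Asymptotics
open scoped RealInnerProductSpace

universe u v w z

/-- A finite stochastic game with random stopping: players `ι`, states `S`, action sets `A i`.
`trans s a s'` is the probability of moving from `s` to `s'` under the action profile `a`; the
missing mass `1 - ∑ s', trans s a s'` is the (positive) probability that the episode stops. -/
structure StochasticGame (ι : Type u) (S : Type v) (A : ι → Type w) [Fintype S] where
  reward : ι → S → (∀ i, A i) → ℝ
  reward_mem : ∀ i s a, reward i s a ∈ Set.Icc (-1 : ℝ) 1
  trans : S → (∀ i, A i) → S → ℝ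
  trans_nonneg : ∀ s a s', 0 ≤ trans s a s'
  trans_sum_lt_one : ∀ s a, ∑ s', trans s a s' < 1
  init : S → ℝ
  init_mem : init ∈ stdSimplex ℝ S

/-- The Euclidean space containing the policy profiles: the coordinate `⟨i, (s, a)⟩` of `x` is
the weight `x_i(a | s)`. -/
abbrev ProfileSpace (ι : Type u) (S : Type v) (A : ι → Type w) : Type (max u v w) :=
  EuclideanSpace ℝ (Σ i, S × A i)

/-- The set `Π = ∏ i, Δ(A i)^S` of stationary Markovian policy profiles. -/
def policySet (ι : Type u) (S : Type v) (A : ι → Type w) [∀ i, Fintype (A i)] :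
    Set (ProfileSpace ι S A) :=
  {x | ∀ i s, (fun a : A i => x ⟨i, (s, a)⟩) ∈ stdSimplex ℝ (A i)}

namespace StochasticGame

section Game

variable {ι : Type u} {S : Type v} {A : ι → Type w}
  [Fintype ι] [DecidableEq ι] [Fintype S] [∀ i, Fintype (A i)]

/-- The probability that an episode stops at state `s` under the action profile `a`. -/
def stopProb (G : StochasticGame ι S A) (s : S) (a : ∀ i, A i) : ℝ :=
  1 - ∑ s', G.trans s a s'

/-- The probability, when the profile `x` is played, that an episode stops at time `T` having
produced the states and action profiles `τ 0, …, τ T`. The formula is a polynomial in `x`, and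
makes sense on the whole ambient space. -/
def trajWeight (G : StochasticGame ι S A) (x : ProfileSpace ι S A) (T : ℕ)
    (τ : Fin (T + 1) → S × (∀ i, A i)) : ℝ :=
  G.init (τ 0).1
    * (∏ t : Fin (T + 1), ∏ i, x ⟨i, ((τ t).1, (τ t).2 i)⟩)
    * (∏ t : Fin T, G.trans (τ t.castSucc).1 (τ t.castSucc).2 (τ t.succ).1)
    * G.stopProb (τ (Fin.last T)).1 (τ (Fin.last T)).2

/-- The value function `V_{i,ρ}(x)`: the expectation, over all the (finite) trajectories of an
episode, of the total reward `∑ t ≤ T, r_i(s_t, a_t)` of player `i`. -/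
noncomputable def value (G : StochasticGame ι S A) (i : ι) (x : ProfileSpace ι S A) : ℝ :=
  ∑' T : ℕ, ∑ τ : Fin (T + 1) → S × (∀ i, A i),
    G.trajWeight x T τ * ∑ t, G.reward i (τ t).1 (τ t).2

/-- The field of individual policy gradients `v(x) = (∇_i V_{i,ρ}(x))_i`: the block of player `i`
consists of the partial derivatives of `V_{i,ρ}` with respect to the coordinates of `x_i`. -/
noncomputable def gradField (G : StochasticGame ι S A) (x : ProfileSpace ι S A) :
    ProfileSpace ι S A :=
  WithLp.toLp 2 fun j => gradient (G.value j.1) x j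

/-- `x` is a Nash policy: no player gains by a unilateral deviation, i.e. by a change of
policy profile to some `y` that differs from `x` only in the policy of this player. -/
def IsNash (G : StochasticGame ι S A) (x : ProfileSpace ι S A) : Prop :=
  x ∈ policySet ι S A ∧
    ∀ i, ∀ y ∈ policySet ι S A, (∀ j, j.1 ≠ i → y j = x j) → G.value i y ≤ G.value i x

/-- `x` is a stable Nash policy: `⟨v(y), y - x⟩ < 0` for all policies `y ≠ x` close to `x`. -/
def IsStableNash (G : StochasticGame ι S A) (x : ProfileSpace ι S A) : Prop :=
  G.IsNash x ∧ ∀ᶠ y in 𝓝[policySet ι S A \ {x}] x, ⟪G.gradField y, y - x⟫ < 0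

end Game

end StochasticGame

/-- `y` is the Euclidean projection of `x` to `K`: a point of `K` nearest to `x`. -/
def IsEuclideanProj {E : Type*} [NormedAddCommGroup E] (K : Set E) (x y : E) : Prop :=
  y ∈ K ∧ ∀ k ∈ K, ‖x - y‖ ≤ ‖x - k‖

/-- The history `σ(X 1, …, X n)` of a process up to and including stage `n`. -/
abbrev history {Ω E : Type*} [MeasurableSpace E] (X : ℕ → Ω → E) (n : ℕ) : MeasurableSpace Ω :=
  ⨆ k ∈ Set.Icc 1 n, MeasurableSpace.comap (X k) inferInstance

namespace StochasticGame

section Dynamics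

variable {ι : Type u} {S : Type v} {A : ι → Type w}
  [Fintype ι] [DecidableEq ι] [Fintype S] [∀ i, Fintype (A i)]

/-- The noise `Y_n - E[Y_n | F_n]` of the gradient signal `Y` at stage `n`. -/
noncomputable def noise {Ω : Type z} [MeasurableSpace Ω] (μ : Measure Ω)
    (X Y : ℕ → Ω → ProfileSpace ι S A) (n : ℕ) : Ω → ProfileSpace ι S A :=
  fun ω => Y n ω - (μ[Y n | history X n]) ω

/-- The bias `E[Y_n | F_n] - v(X_n)` of the gradient signal `Y` at stage `n`. -/
noncomputable def bias (G : StochasticGame ι S A) {Ω : Type z} [MeasurableSpace Ω] (μ : Measure Ω)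
    (X Y : ℕ → Ω → ProfileSpace ι S A) (n : ℕ) : Ω → ProfileSpace ι S A :=
  fun ω => (μ[Y n | history X n]) ω - G.gradField (X n ω)

/-- `X 1, X 2, …` is a sequence of play of projected policy gradient with step-size
`γ / (n + m) ^ p` and gradient signals `Y 1, Y 2, …` (the index `0` is not used), where the
signals have bias at most `B n` and mean square noise at most `σ n ^ 2` at stage `n`,
conditionally on the history of play. -/
structure IsPolicyGradient (G : StochasticGame ι S A) (γ m p : ℝ) (B σ : ℕ → ℝ)
    {Ω : Type z} [MeasurableSpace Ω] (μ : Measure Ω) (X Y : ℕ → Ω → ProfileSpace ι S A) :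
    Prop where
  measurable : ∀ n, 1 ≤ n → Measurable (X n)
  memLp : ∀ n, 1 ≤ n → MemLp (Y n) 2 μ
  init_mem : ∀ ω, X 1 ω ∈ policySet ι S A
  update : ∀ n, 1 ≤ n → ∀ ω, IsEuclideanProj (policySet ι S A)
    (X n ω + (γ / ((n : ℝ) + m) ^ p) • Y n ω) (X (n + 1) ω)
  bias_le : ∀ n, 1 ≤ n → ∀ᵐ ω ∂μ,
    (μ[fun ω' => ‖G.bias μ X Y n ω'‖ | history X n]) ω ≤ B n
  noise_le : ∀ n, 1 ≤ n → ∀ᵐ ω ∂μ,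
    (μ[fun ω' => ‖noise μ X Y n ω'‖ ^ 2 | history X n]) ω ≤ σ n ^ 2

/-- Every sequence of play of projected policy gradient with the given parameters satisfies
`P(X n → x | X 1 ∈ U) ≥ 1 - δ` (whenever the event `X 1 ∈ U` has positive probability). -/
def LocallyConvergent (G : StochasticGame ι S A) (x : ProfileSpace ι S A)
    (U : Set (ProfileSpace ι S A)) (δ γ m p : ℝ) (B σ : ℕ → ℝ) : Prop :=
  ∀ (Ω : Type z) [MeasurableSpace Ω] (μ : Measure Ω) [IsProbabilityMeasure μ]
    (X Y : ℕ → Ω → ProfileSpace ι S A), G.IsPolicyGradient γ m p B σ μ X Y →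
    μ {ω | X 1 ω ∈ U} ≠ 0 →
    ENNReal.ofReal (1 - δ) ≤
      μ[{ω | Tendsto (fun n => X n ω) atTop (𝓝 x)} | {ω | X 1 ω ∈ U}]

end Dynamics

end StochasticGame

/-!
Write `W n = ‖X (n + 1) - x‖ ^ 2`. Projecting to the convex set `policySet` decreases the distance
to `x`, so that `W` has conditional drift at most `2 γ_n ⟪v (X n), X n - x⟫` plus an error that
consists of a first order term in the bias and of second order terms
(`ae_condExp_norm_sub_sq_le`). As long as the play is in the ball where `x` is stable, the main term
is nonpositive, and the total error is finite, and small if `γ` is small or `m` is large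
(`summable_and_tsum_stepError_le`).

The gradient signals, and hence their noise, are not measurable with respect to the later
histories of play, so the noise terms `⟪U_n, X n - x⟫` are not martingale differences for these
histories. The argument uses the Doob decomposition of the adapted process `W` instead: its martingale
part, frozen when the play leaves the ball, has orthogonal increments, whose second moments are
controlled because the projection is nonexpansive (`ae_condExp_sq_norm_sub_sq_le`). A play that starts
in the smaller ball `U` can leave the larger ball only if this martingale is large, which has a small
probability by Chebyshev's inequality; all the moments are taken on the event `X 1 ∈ U`, so that this
probability is small relative to the probability of `X 1 ∈ U`. On the rest of that event
the martingale converges, hence so does `W`, and `∑ γ_n ⟪v (X n), X n - x⟫` converges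
(`measureReal_diff_le_of_drift`). As `∑ γ_n = ∞` and the inner product is bounded away from `0`
outside every neighborhood of `x`, the limit of `W` is `0` (`tendsto_of_summable_mul`).

The field `v` must be continuous on `policySet` for this. The value functions are smooth near
`policySet` as they have the form `ℓ ((1 - L x)⁻¹ (g x))`, with a linear functional `ℓ`, a vector `g x`
and an operator `L x` that are polynomial in `x`, and `‖L x‖ < 1`: the sum over the trajectories of a
given length is a power of `L x` applied to `g x` (`sum_tailWeight`, `value_eq_inverse`).
-/

/-! ### Almost supermartingales -/

section MartingaleDifferences

variable {Ω : Type*} {m0 : MeasurableSpace Ω} {μ : Measure Ω}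
  {ℱ : Filtration ℕ m0} {D : ℕ → Ω → ℝ}

theorem stronglyMeasurable_sum_range (hD : ∀ n, StronglyMeasurable[ℱ (n + 1)] (D n)) (n : ℕ) :
    StronglyMeasurable[ℱ n] (∑ k ∈ Finset.range n, D k) :=
  Finset.stronglyMeasurable_sum _ fun k hk =>
    (hD k).mono (ℱ.mono (Finset.mem_range.1 hk))

theorem memLp_sum_range (hD2 : ∀ n, MemLp (D n) 2 μ) (n : ℕ) :
    MemLp (∑ k ∈ Finset.range n, D k) 2 μ :=
  memLp_finsetSum' _ fun k _ => hD2 k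

variable [IsProbabilityMeasure μ]

theorem integral_mul_eq_zero_of_condExp_eq_zero {m : MeasurableSpace Ω} (hm : m ≤ m0)
    {f g : Ω → ℝ} (hf : StronglyMeasurable[m] f) (hf2 : MemLp f 2 μ) (hg2 : MemLp g 2 μ)
    (hg : μ[g | m] =ᵐ[μ] 0) : ∫ ω, f ω * g ω ∂μ = 0 := by
  have hint : Integrable (f * g) μ := hf2.integrable_mul hg2
  have h1 := condExp_mul_of_stronglyMeasurable_left hf hint (hg2.integrable one_le_two)
  calc ∫ ω, f ω * g ω ∂μ = ∫ ω, (μ[f * g | m]) ω ∂μ := (integral_condExp hm).symm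
    _ = ∫ _, (0 : ℝ) ∂μ := by
        refine integral_congr_ae ?_
        filter_upwards [h1, hg] with ω h1 h2
        simp [h1, h2]
    _ = 0 := by simp

/-- Martingale differences are orthogonal in `L²`. -/
theorem integral_sum_range_sq (hD : ∀ n, StronglyMeasurable[ℱ (n + 1)] (D n))
    (hD2 : ∀ n, MemLp (D n) 2 μ) (hD0 : ∀ n, μ[D n | ℱ n] =ᵐ[μ] 0) (n : ℕ) :
    ∫ ω, (∑ k ∈ Finset.range n, D k) ω ^ 2 ∂μ = ∑ k ∈ Finset.range n, ∫ ω, D k ω ^ 2 ∂μ := by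
  induction n with
  | zero => simp
  | succ n ih =>
    have h2 := memLp_sum_range hD2 n
    have hx := integral_mul_eq_zero_of_condExp_eq_zero (ℱ.le n)
      (stronglyMeasurable_sum_range hD n) h2 (hD2 n) (hD0 n)
    have hint : Integrable (fun ω => (∑ k ∈ Finset.range n, D k) ω * D n ω) μ :=
      h2.integrable_mul (hD2 n)
    rw [Finset.sum_range_succ (fun k => ∫ ω, D k ω ^ 2 ∂μ), ← ih]
    calc ∫ ω, (∑ k ∈ Finset.range (n + 1), D k) ω ^ 2 ∂μ
        = ∫ ω, ((∑ k ∈ Finset.range n, D k) ω ^ 2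
            + 2 * ((∑ k ∈ Finset.range n, D k) ω * D n ω)) + D n ω ^ 2 ∂μ := by
          refine integral_congr_ae (ae_of_all _ fun ω => ?_)
          simp only [Finset.sum_range_succ, Pi.add_apply]
          ring
      _ = _ := by
          have hadd : Integrable (fun ω => (∑ k ∈ Finset.range n, D k) ω ^ 2
              + 2 * ((∑ k ∈ Finset.range n, D k) ω * D n ω)) μ :=
            h2.integrable_sq.add (hint.const_mul 2)
          rw [integral_add hadd (hD2 n).integrable_sq,
            integral_add h2.integrable_sq (hint.const_mul 2), integral_const_mul, hx]
          ring

theorem ae_tendsto_sum_range (hD : ∀ n, StronglyMeasurable[ℱ (n + 1)] (D n))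
    (hD2 : ∀ n, MemLp (D n) 2 μ) (hD0 : ∀ n, μ[D n | ℱ n] =ᵐ[μ] 0) {C : ℝ}
    (hC : ∀ n, ∑ k ∈ Finset.range n, ∫ ω, D k ω ^ 2 ∂μ ≤ C) :
    ∀ᵐ ω ∂μ, ∃ c, Tendsto (fun n => (∑ k ∈ Finset.range n, D k) ω) atTop (𝓝 c) := by
  have hmart : Martingale (fun n => ∑ k ∈ Finset.range n, D k) ℱ μ := by
    refine martingale_of_condExp_sub_eq_zero_nat (stronglyMeasurable_sum_range hD)
      (fun n => (memLp_sum_range hD2 n).integrable one_le_two) fun n => ?_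
    simpa [Finset.sum_range_succ] using hD0 n
  refine hmart.submartingale.exists_ae_tendsto_of_bdd
    (R := Real.toNNReal (1 + C)) fun n => ?_
  have h2 := memLp_sum_range hD2 n
  rw [eLpNorm_one_eq_lintegral_enorm, ← ofReal_integral_norm_eq_lintegral_enorm
    (h2.integrable one_le_two)]
  refine ENNReal.ofReal_le_ofReal ?_
  calc ∫ ω, ‖(∑ k ∈ Finset.range n, D k) ω‖ ∂μ
      ≤ ∫ ω, (1 + (∑ k ∈ Finset.range n, D k) ω ^ 2) ∂μ := by
        refine integral_mono (h2.integrable one_le_two).norm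
          ((integrable_const 1).add h2.integrable_sq) fun ω => ?_
        have := sq_abs ((∑ k ∈ Finset.range n, D k) ω)
        simp only [Real.norm_eq_abs]
        nlinarith [sq_nonneg (|(∑ k ∈ Finset.range n, D k) ω| - 1),
          abs_nonneg ((∑ k ∈ Finset.range n, D k) ω)]
    _ = 1 + ∑ k ∈ Finset.range n, ∫ ω, D k ω ^ 2 ∂μ := by
        rw [integral_add (integrable_const 1) h2.integrable_sq,
          integral_sum_range_sq hD hD2 hD0]
        simp
    _ ≤ 1 + C := by linarith [hC n]

end MartingaleDifferences

theorem tendsto_and_summable_of_le_sub_add {W h ε M : ℕ → ℝ} (hW : ∀ n, 0 ≤ W n)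
    (hh : ∀ n, 0 ≤ h n) (hε : Summable ε) {c : ℝ} (hM : Tendsto M atTop (𝓝 c))
    (hle : ∀ n, W (n + 1) ≤ W n - h n + ε n + (M (n + 1) - M n)) :
    (∃ l, Tendsto W atTop (𝓝 l)) ∧ Summable h := by
  set Q : ℕ → ℝ := fun n => W n - ∑ k ∈ Finset.range n, ε k - M n with hQ
  have hstep : ∀ n, Q (n + 1) ≤ Q n - h n := fun n => by
    simp only [hQ, Finset.sum_range_succ]
    linarith [hle n]
  have hsum : Tendsto (fun n => ∑ k ∈ Finset.range n, ε k + M n) atTop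
    (𝓝 (∑' k, ε k + c)) := hε.hasSum.tendsto_sum_nat.add hM
  obtain ⟨b, hb⟩ := hsum.bddAbove_range
  have hQb : ∀ n, -b ≤ Q n := fun n => by
    have := hb ⟨n, rfl⟩
    simp only [hQ] at this ⊢
    linarith [hW n]
  constructor
  · have hanti : Antitone Q := antitone_nat_of_succ_le fun n => by linarith [hstep n, hh n]
    have hlim := tendsto_atTop_ciInf hanti ⟨-b, by rintro _ ⟨n, rfl⟩; exact hQb n⟩
    refine ⟨_, (hlim.add hsum).congr fun n => ?_⟩
    simp only [hQ]
    ring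
  · refine summable_of_sum_range_le (c := Q 0 + b) hh fun n => ?_
    have : ∀ n, ∑ k ∈ Finset.range n, h k ≤ Q 0 - Q n := fun n => by
      induction n with
      | zero => simp
      | succ n ih => rw [Finset.sum_range_succ]; linarith [hstep n]
    linarith [this n, hQb n]

/-- A bounded nonnegative process `W` that, as long as it is below the level `R`, has conditional
drift at most `ε n - h n` with `h n ≥ 0`, and whose increments have conditional second moment at
most `s n`: if it starts below `R / 4` on the event `A`, then on `A` it stays below `R` forever and
converges, with `∑ h n < ∞`, except on a set of relative probability `4 ∑ s n / R ^ 2`. The martingale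
part of `W`, frozen at the exit from `[0, R]`, is bounded in `L²`; to leave `[0, R]` it has to
reach `R / 2`, where it then remains, so that Chebyshev's inequality suffices. -/
theorem measureReal_diff_le_of_drift {Ω : Type*} {m0 : MeasurableSpace Ω} {μ : Measure Ω}
    [IsProbabilityMeasure μ] (ℱ : Filtration ℕ m0) {W h : ℕ → Ω → ℝ} {C R : ℝ} {ε s : ℕ → ℝ}
    {A : Set Ω} (hA : MeasurableSet[ℱ 0] A) (hW : ∀ n, StronglyMeasurable[ℱ n] (W n))
    (hW0 : ∀ n ω, 0 ≤ W n ω) (hWC : ∀ n ω, W n ω ≤ C)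
    (hh : ∀ n ω, W n ω ≤ R → 0 ≤ h n ω)
    (hdrift : ∀ n, ∀ᵐ ω ∂μ, W n ω ≤ R → (μ[W (n + 1) - W n | ℱ n]) ω ≤ ε n - h n ω)
    (hvar : ∀ n, ∀ᵐ ω ∂μ, (μ[(W (n + 1) - W n) ^ 2 | ℱ n]) ω ≤ s n)
    (hε0 : ∀ n, 0 ≤ ε n) (hε : Summable ε) (hεR : ∑' n, ε n ≤ R / 4)
    (hs0 : ∀ n, 0 ≤ s n) (hs : Summable s) (hR : 0 < R) (hAR : ∀ ω ∈ A, W 0 ω ≤ R / 4) :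
    μ.real (A \ {ω | (∀ n, W n ω ≤ R) ∧ (∃ l, Tendsto (fun n => W n ω) atTop (𝓝 l)) ∧
        Summable (fun n => h n ω)}) ≤ 4 * (∑' n, s n) / R ^ 2 * μ.real A := by
  set Z : ℕ → Ω → ℝ := fun n => W (n + 1) - W n with hZ
  set E : ℕ → Set Ω := fun n => A ∩ ⋂ k ∈ Finset.range (n + 1), {ω | W k ω ≤ R} with hE
  have hEmem : ∀ n ω, ω ∈ E n ↔ ω ∈ A ∧ ∀ k ≤ n, W k ω ≤ R := fun n ω => by
    simp [hE]
  have hEmeas : ∀ n, MeasurableSet[ℱ n] (E n) := fun n => by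
    refine (ℱ.mono (Nat.zero_le n) _ hA).inter ?_
    refine Finset.measurableSet_biInter _ fun k hk => ?_
    exact ℱ.mono (Nat.lt_succ_iff.1 (Finset.mem_range.1 hk)) _
      (@measurableSet_le _ _ _ _ _ (ℱ k) _ _ _ _ _ (hW k).measurable
        (@measurable_const _ _ _ (ℱ k) _))
  have hW2 : ∀ n, MemLp (W n) 2 μ := fun n =>
    MemLp.of_bound ((hW n).mono (ℱ.le n)).aestronglyMeasurable C (ae_of_all _ fun ω => by
      rw [Real.norm_eq_abs, abs_of_nonneg (hW0 n ω)]; exact hWC n ω)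
  have hZ2 : ∀ n, MemLp (Z n) 2 μ := fun n => (hW2 (n + 1)).sub (hW2 n)
  have hZm : ∀ n, StronglyMeasurable[ℱ (n + 1)] (Z n) := fun n =>
    (hW (n + 1)).sub ((hW n).mono (ℱ.mono n.le_succ))
  have hξ2 : ∀ n, MemLp (Z n - μ[Z n | ℱ n]) 2 μ := fun n =>
    (hZ2 n).sub ((hZ2 n).condExp one_le_two)
  set D : ℕ → Ω → ℝ := fun n => (E n).indicator (Z n - μ[Z n | ℱ n]) with hD
  have hDm : ∀ n, StronglyMeasurable[ℱ (n + 1)] (D n) := fun n =>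
    ((hZm n).sub (stronglyMeasurable_condExp.mono (ℱ.mono n.le_succ))).indicator
      (ℱ.mono n.le_succ _ (hEmeas n))
  have hD2 : ∀ n, MemLp (D n) 2 μ := fun n => (hξ2 n).indicator (ℱ.le n _ (hEmeas n))
  have hD0 : ∀ n, μ[D n | ℱ n] =ᵐ[μ] 0 := fun n => by
    have h1 := condExp_indicator (μ := μ) ((hξ2 n).integrable one_le_two) (hEmeas n)
    have h2 := condExp_sub (μ := μ) ((hZ2 n).integrable one_le_two)
      (integrable_condExp (m := ℱ n) (f := Z n)) (ℱ n)
    have h3 : μ[μ[Z n | ℱ n] | ℱ n] = μ[Z n | ℱ n] :=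
      condExp_of_stronglyMeasurable (ℱ.le n) stronglyMeasurable_condExp integrable_condExp
    filter_upwards [h1, h2] with ω h1 h2
    rw [h1, Pi.zero_apply]
    by_cases hω : ω ∈ E n
    · rw [Set.indicator_of_mem hω, h2, h3]; simp
    · rw [Set.indicator_of_notMem hω]
  have hDs : ∀ n, ∫ ω, D n ω ^ 2 ∂μ ≤ s n * μ.real A := fun n => by
    have hEm := ℱ.le n _ (hEmeas n)
    calc ∫ ω, D n ω ^ 2 ∂μ
        = ∫ ω in E n, (Z n ω - (μ[Z n | ℱ n]) ω) ^ 2 ∂μ := by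
          rw [← integral_indicator hEm]
          refine integral_congr_ae (ae_of_all _ fun ω => ?_)
          by_cases hω : ω ∈ E n <;> simp [hD, hω]
      _ = ∫ ω in E n, (condVar (ℱ n) (Z n) μ) ω ∂μ :=
          (setIntegral_condVar (hm := ℱ.le n) (hξ2 n).integrable_sq (hEmeas n)).symm
      _ ≤ ∫ _ in E n, s n ∂μ := by
          refine setIntegral_mono_ae integrable_condVar.integrableOn
            (integrable_const _).integrableOn ?_
          filter_upwards [condVar_ae_le_condExp_sq (ℱ.le n) (hZ2 n), hvar n] with ω h1 h2
          exact h1.trans h2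
      _ = s n * μ.real (E n) := by simp [mul_comm]
      _ ≤ s n * μ.real A :=
          mul_le_mul_of_nonneg_left (measureReal_mono Set.inter_subset_left) (hs0 n)
  have hDsum : ∀ n, ∑ k ∈ Finset.range n, ∫ ω, D k ω ^ 2 ∂μ ≤ (∑' k, s k) * μ.real A := fun n =>
    calc _ ≤ ∑ k ∈ Finset.range n, s k * μ.real A := Finset.sum_le_sum fun k _ => hDs k
      _ = (∑ k ∈ Finset.range n, s k) * μ.real A := (Finset.sum_mul _ _ _).symm
      _ ≤ _ := mul_le_mul_of_nonneg_right (hs.sum_le_tsum _ fun k _ => hs0 k) measureReal_nonneg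
  set M : ℕ → Ω → ℝ := fun n => ∑ k ∈ Finset.range n, D k with hM
  have hMsucc : ∀ n ω, M (n + 1) ω = M n ω + D n ω := fun n ω => by
    simp [hM, Finset.sum_range_succ]
  set S : ℕ → Set Ω := fun N => {ω | ∀ n ≥ N, R / 2 ≤ M n ω} with hS
  have hSmono : Monotone S := fun N N' hN ω hω n hn => hω n (hN.trans hn)
  have hSbound : ∀ N, μ (S N) ≤ ENNReal.ofReal (4 * (∑' n, s n) / R ^ 2 * μ.real A) := fun N => by
    have hcheb := mul_meas_ge_le_integral_of_nonneg (μ := μ) (f := fun ω => M N ω ^ 2)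
      (ae_of_all _ fun ω => sq_nonneg _) (memLp_sum_range hD2 N).integrable_sq ((R / 2) ^ 2)
    have hint : ∫ ω, M N ω ^ 2 ∂μ ≤ (∑' k, s k) * μ.real A :=
      (integral_sum_range_sq hDm hD2 hD0 N).le.trans (hDsum N)
    refine (measure_mono (t := {ω | (R / 2) ^ 2 ≤ M N ω ^ 2}) fun ω (hω : ω ∈ S N) =>
      show (R / 2) ^ 2 ≤ M N ω ^ 2 from pow_le_pow_left₀ (by positivity) (hω N le_rfl) 2).trans ?_
    rw [← ofReal_measureReal]
    refine ENNReal.ofReal_le_ofReal ?_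
    have hR2 : 0 < (R / 2) ^ 2 := by positivity
    refine le_of_mul_le_mul_left (hcheb.trans (hint.trans (le_of_eq ?_))) hR2
    field_simp
    ring
  have hSU : μ (⋃ N, S N) ≤ ENNReal.ofReal (4 * (∑' n, s n) / R ^ 2 * μ.real A) := by
    rw [hSmono.measure_iUnion]
    exact iSup_le hSbound
  have hdom : ∀ᵐ ω ∂μ, ω ∈ A \ {ω | (∀ n, W n ω ≤ R) ∧
      (∃ l, Tendsto (fun n => W n ω) atTop (𝓝 l)) ∧ Summable (fun n => h n ω)} →
      ω ∈ ⋃ N, S N := by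
    filter_upwards [ae_all_iff.2 hdrift, ae_tendsto_sum_range hDm hD2 hD0 hDsum]
      with ω hdr hMlim ⟨hωA, hωG⟩
    have hinc : ∀ n, ω ∈ E n → W (n + 1) ω ≤ W n ω - h n ω + ε n + (M (n + 1) ω - M n ω) := by
      intro n hn
      have h1 := hdr n (((hEmem n ω).1 hn).2 n le_rfl)
      have h2 : D n ω = W (n + 1) ω - W n ω - (μ[Z n | ℱ n]) ω := by
        simp [hD, hn, hZ]
      rw [hMsucc, h2]
      linarith
    by_cases hstay : ∀ n, W n ω ≤ R
    · exfalso
      obtain ⟨c, hc⟩ := hMlim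
      exact hωG ⟨hstay, tendsto_and_summable_of_le_sub_add (fun n => hW0 n ω)
        (fun n => hh n ω (hstay n)) hε hc fun n => hinc n ((hEmem n ω).2 ⟨hωA, fun k _ => hstay k⟩)⟩
    · push Not at hstay
      classical
      -- `N` is the exit time; before it, `W` is controlled by its martingale part.
      set N := Nat.find hstay with hN
      have hNspec : R < W N ω := Nat.find_spec hstay
      have hbefore : ∀ k < N, ω ∈ E k := fun k hk => (hEmem k ω).2 ⟨hωA, fun j hj =>
        not_lt.1 (Nat.find_min hstay (hj.trans_lt hk))⟩
      have hcontrol : ∀ n ≤ N, W n ω ≤ W 0 ω + ∑ k ∈ Finset.range n, ε k + M n ω := by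
        intro n
        induction n with
        | zero => intro _; simp [hM]
        | succ n ih =>
          intro hn
          have hEn := hbefore n hn
          rw [Finset.sum_range_succ]
          linarith [ih (by omega), hinc n hEn, hh n ω (((hEmem n ω).1 hEn).2 n le_rfl)]
      have hMN : R / 2 ≤ M N ω := by
        linarith [hcontrol N le_rfl, hAR ω hωA,
          hε.sum_le_tsum (Finset.range N) fun k _ => hε0 k]
      refine Set.mem_iUnion.2 ⟨N, fun n hn => ?_⟩
      induction n, hn using Nat.le_induction with
      | base => exact hMN
      | succ n hn ih =>
        have hnE : ω ∉ E n := fun hE => (((hEmem n ω).1 hE).2 N hn).not_gt hNspec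
        rw [hMsucc]
        simpa [hD, hnE] using ih
  refine ENNReal.toReal_le_of_le_ofReal ?_ ((measure_mono_ae hdom).trans hSU)
  have : 0 ≤ ∑' n, s n := tsum_nonneg hs0
  positivity

/-! ### Smoothness of the value functions -/

namespace StochasticGame

variable {ι : Type u} {S : Type v} {A : ι → Type w}

theorem abs_reward_le [Fintype S] (G : StochasticGame ι S A) (i : ι) (s : S) (a : ∀ i, A i) :
    |G.reward i s a| ≤ 1 := abs_le.2 (G.reward_mem i s a)

variable [Fintype ι]

/-- The weight `∏ i, x_i(a_i | s)` of the action profile `a` at the state `s`. -/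
def actionWeight (x : ProfileSpace ι S A) (s : S) (a : ∀ i, A i) : ℝ :=
  ∏ i, x ⟨i, (s, a i)⟩

/-- `trajWeight` without the factor of the initial state. -/
noncomputable def tailWeight [Fintype S] (G : StochasticGame ι S A) (x : ProfileSpace ι S A) (T : ℕ)
    (τ : Fin (T + 1) → S × (∀ i, A i)) : ℝ :=
  (∏ t : Fin (T + 1), actionWeight x (τ t).1 (τ t).2)
    * (∏ t : Fin T, G.trans (τ t.castSucc).1 (τ t.castSucc).2 (τ t.succ).1)
    * G.stopProb (τ (Fin.last T)).1 (τ (Fin.last T)).2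

theorem tailWeight_cons [Fintype S] (G : StochasticGame ι S A) (x : ProfileSpace ι S A) (T : ℕ)
    (q : S × (∀ i, A i)) (τ : Fin (T + 1) → S × (∀ i, A i)) :
    G.tailWeight x (T + 1) (Fin.cons q τ : Fin (T + 2) → S × (∀ i, A i))
      = actionWeight x q.1 q.2 * G.trans q.1 q.2 (τ 0).1 * G.tailWeight x T τ := by
  have hact : ∏ t : Fin (T + 2), actionWeight x ((Fin.cons q τ : Fin (T + 2) → S × (∀ i, A i)) t).1
      ((Fin.cons q τ : Fin (T + 2) → S × (∀ i, A i)) t).2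
      = actionWeight x q.1 q.2 * ∏ t : Fin (T + 1), actionWeight x (τ t).1 (τ t).2 := by
    rw [Fin.prod_univ_succ]
    simp only [Fin.cons_zero, Fin.cons_succ]
  have htrans : ∏ t : Fin (T + 1),
      G.trans ((Fin.cons q τ : Fin (T + 2) → S × (∀ i, A i)) t.castSucc).1
        ((Fin.cons q τ : Fin (T + 2) → S × (∀ i, A i)) t.castSucc).2
        ((Fin.cons q τ : Fin (T + 2) → S × (∀ i, A i)) t.succ).1
      = G.trans q.1 q.2 (τ 0).1 *
        ∏ t : Fin T, G.trans (τ t.castSucc).1 (τ t.castSucc).2 (τ t.succ).1 := by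
    rw [Fin.prod_univ_succ]
    simp only [Fin.castSucc_zero, Fin.cons_zero, Fin.cons_succ, ← Fin.succ_castSucc]
  unfold tailWeight
  rw [hact, htrans, ← Fin.succ_last, Fin.cons_succ]
  ring

variable [∀ i, Fintype (A i)]

theorem actionWeight_nonneg {x : ProfileSpace ι S A} (hx : x ∈ policySet ι S A) (s : S)
    (a : ∀ i, A i) : 0 ≤ actionWeight x s a :=
  Finset.prod_nonneg fun i _ => (hx i s).1 (a i)

theorem sum_actionWeight [DecidableEq ι] {x : ProfileSpace ι S A} (hx : x ∈ policySet ι S A) (s : S) :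
    ∑ a, actionWeight x s a = 1 := by
  unfold actionWeight
  rw [← Fintype.piFinset_univ,
    ← Finset.prod_univ_sum (fun _ => Finset.univ) fun i (b : A i) => x ⟨i, (s, b)⟩]
  exact Finset.prod_eq_one fun i _ => (hx i s).2

variable [Fintype S]

theorem contDiff_actionWeight (s : S) (a : ∀ i, A i) {n : WithTop ℕ∞} :
    ContDiff ℝ n fun x : ProfileSpace ι S A => actionWeight x s a := by
  unfold actionWeight
  refine contDiff_prod fun i _ => ?_
  fun_prop

theorem exists_sum_trans_le (G : StochasticGame ι S A) :
    ∃ κ : ℝ, 0 ≤ κ ∧ κ < 1 ∧ ∀ s a, ∑ s', G.trans s a s' ≤ κ := by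
  classical
  rcases isEmpty_or_nonempty (S × (∀ i, A i)) with h | h
  · exact ⟨0, le_rfl, one_pos, fun s a => (h.false (s, a)).elim⟩
  · obtain ⟨q, hq⟩ := Finite.exists_max fun q : S × (∀ i, A i) => ∑ s', G.trans q.1 q.2 s'
    exact ⟨_, Finset.sum_nonneg fun s' _ => G.trans_nonneg q.1 q.2 s', G.trans_sum_lt_one _ _,
      fun s a => hq (s, a)⟩

variable [DecidableEq ι]

/-- One step of the game as a linear operator on pairs of functions of the state: `f s = (w s, u s)`
is sent to the pair of `∑ x(a|s) P(s'|s,a) w(s')` and `∑ x(a|s) P(s'|s,a) (u(s') + η r(s,a) w(s'))`.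
The powers of it propagate the weight and `η` times the reward of the trajectories. A small scale
`η > 0` makes it a contraction. -/
noncomputable def step (G : StochasticGame ι S A) (i : ι) (η : ℝ) (x : ProfileSpace ι S A) :
    (S → ℝ × ℝ) →L[ℝ] (S → ℝ × ℝ) :=
  ∑ s, ∑ a, ∑ s', (actionWeight x s a * G.trans s a s') •
    (by classical exact ContinuousLinearMap.single ℝ (fun _ : S => ℝ × ℝ) s) ∘L
    ((ContinuousLinearMap.fst ℝ ℝ ℝ).prod (ContinuousLinearMap.snd ℝ ℝ ℝ
      + (η * G.reward i s a) • ContinuousLinearMap.fst ℝ ℝ ℝ)) ∘L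
    ContinuousLinearMap.proj (R := ℝ) (φ := fun _ : S => ℝ × ℝ) s'

/-- The weight of stopping at once, and `η` times the expected reward of the last stage. -/
noncomputable def terminal (G : StochasticGame ι S A) (i : ι) (η : ℝ) (x : ProfileSpace ι S A) :
    S → ℝ × ℝ :=
  fun s => (∑ a, actionWeight x s a * G.stopProb s a,
    ∑ a, actionWeight x s a * G.stopProb s a * (η * G.reward i s a))

theorem step_apply (G : StochasticGame ι S A) (i : ι) (η : ℝ) (x : ProfileSpace ι S A)
    (f : S → ℝ × ℝ) (s : S) :
    G.step i η x f s = (∑ a, ∑ s', actionWeight x s a * G.trans s a s' * (f s').1,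
      ∑ a, ∑ s', actionWeight x s a * G.trans s a s' *
        ((f s').2 + η * G.reward i s a * (f s').1)) := by
  classical
  simp only [step, sum_apply, smul_apply,
    ContinuousLinearMap.comp_apply, Finset.sum_apply, Pi.smul_apply]
  rw [Finset.sum_eq_single s]
  · simp [Prod.ext_iff, Prod.fst_sum, Prod.snd_sum]
  · intro t _ ht
    simp [ht.symm]
  · simp

theorem contDiff_step (G : StochasticGame ι S A) (i : ι) (η : ℝ) {n : WithTop ℕ∞} :
    ContDiff ℝ n (G.step i η) := by
  unfold step
  refine ContDiff.sum fun s _ => ContDiff.sum fun a _ => ContDiff.sum fun s' _ => ?_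
  exact ((contDiff_actionWeight s a).mul contDiff_const).smul contDiff_const

theorem contDiff_terminal (G : StochasticGame ι S A) (i : ι) (η : ℝ) {n : WithTop ℕ∞} :
    ContDiff ℝ n (G.terminal i η) := by
  refine contDiff_pi.2 fun s => ContDiff.prodMk ?_ ?_
  · exact ContDiff.sum fun a _ => (contDiff_actionWeight s a).mul contDiff_const
  · exact ContDiff.sum fun a _ => ((contDiff_actionWeight s a).mul contDiff_const).mul contDiff_const

/-- The first components contract by the largest continuation probability `κ < 1`, and a scale
`η = (1 - κ) / 2` keeps the factor `κ (1 + η)` of the second ones below `1`. -/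
theorem exists_norm_step_lt_one (G : StochasticGame ι S A) (i : ι) :
    ∃ η : ℝ, 0 < η ∧ ∀ x ∈ policySet ι S A, ‖G.step i η x‖ < 1 := by
  obtain ⟨κ, hκ0, hκ1, hκ⟩ := G.exists_sum_trans_le
  refine ⟨(1 - κ) / 2, by linarith, fun x hx => ?_⟩
  set η := (1 - κ) / 2 with hη
  have hη0 : 0 < η := by linarith
  have hlt : κ * (1 + η) < 1 := by nlinarith
  refine lt_of_le_of_lt (ContinuousLinearMap.opNorm_le_bound _ (by positivity) fun f => ?_) hlt
  have hsum : ∀ (s : S) (F : (∀ i, A i) → S → ℝ) (c : ℝ), 0 ≤ c → (∀ a s', |F a s'| ≤ c) →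
      |∑ a, ∑ s', actionWeight x s a * G.trans s a s' * F a s'| ≤ κ * c := by
    intro s F c hc hF
    have hterm : ∀ a, |∑ s', actionWeight x s a * G.trans s a s' * F a s'|
        ≤ actionWeight x s a * (κ * c) := fun a => by
      have hw := actionWeight_nonneg hx s a
      calc |∑ s', actionWeight x s a * G.trans s a s' * F a s'|
          ≤ ∑ s', |actionWeight x s a * G.trans s a s' * F a s'| := Finset.abs_sum_le_sum_abs _ _
        _ ≤ ∑ s', actionWeight x s a * G.trans s a s' * c := Finset.sum_le_sum fun s' _ => by
            have h0 := mul_nonneg hw (G.trans_nonneg s a s')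
            rw [abs_mul, abs_of_nonneg h0]
            exact mul_le_mul_of_nonneg_left (hF a s') h0
        _ = actionWeight x s a * ((∑ s', G.trans s a s') * c) := by
            rw [← Finset.sum_mul, ← Finset.mul_sum, mul_assoc]
        _ ≤ _ := mul_le_mul_of_nonneg_left (mul_le_mul_of_nonneg_right (hκ s a) hc) hw
    calc _ ≤ ∑ a, |∑ s', actionWeight x s a * G.trans s a s' * F a s'| :=
          Finset.abs_sum_le_sum_abs _ _
      _ ≤ ∑ a, actionWeight x s a * (κ * c) := Finset.sum_le_sum fun a _ => hterm a
      _ = κ * c := by rw [← Finset.sum_mul, sum_actionWeight hx, one_mul]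
  have h1 : ∀ s', |(f s').1| ≤ ‖f‖ := fun s' => (norm_fst_le (f s')).trans (norm_le_pi_norm f s')
  have h2 : ∀ s', |(f s').2| ≤ ‖f‖ := fun s' => (norm_snd_le (f s')).trans (norm_le_pi_norm f s')
  refine (pi_norm_le_iff_of_nonneg (by positivity)).2 fun s => ?_
  rw [step_apply, Prod.norm_def]
  refine max_le ?_ ?_
  · refine (hsum s (fun _ s' => (f s').1) ‖f‖ (norm_nonneg f) fun _ s' => h1 s').trans ?_
    have : 0 ≤ κ * η * ‖f‖ := by positivity
    linarith
  · refine (hsum s (fun a s' => (f s').2 + η * G.reward i s a * (f s').1) ((1 + η) * ‖f‖)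
      (by positivity) fun a s' => ?_).trans (by rw [mul_assoc])
    calc |(f s').2 + η * G.reward i s a * (f s').1|
        ≤ |(f s').2| + |η * G.reward i s a * (f s').1| := abs_add_le _ _
      _ = |(f s').2| + η * (|G.reward i s a| * |(f s').1|) := by
          rw [abs_mul, abs_mul, abs_of_pos hη0, mul_assoc]
      _ ≤ ‖f‖ + η * (1 * ‖f‖) := by
          gcongr
          · exact h2 s'
          · exact G.abs_reward_le i s a
          · exact h1 s'
      _ = (1 + η) * ‖f‖ := by ring

theorem sum_trajectories_succ (T : ℕ) (F : (Fin (T + 2) → S × (∀ i, A i)) → ℝ) :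
    ∑ τ, F τ = ∑ s, ∑ a, ∑ τ : Fin (T + 1) → S × (∀ i, A i), F (Fin.cons (s, a) τ) := by
  rw [← (Fin.consEquiv fun _ => S × (∀ i, A i)).sum_comp, Fintype.sum_prod_type,
    Fintype.sum_prod_type]
  rfl

/-- The sums over the trajectories with `T + 1` stages are read off from the `T`-th power of the
operator `step`, for any weighting `g` of the first state. -/
theorem sum_tailWeight (G : StochasticGame ι S A) (i : ι) {η : ℝ} (x : ProfileSpace ι S A)
    (T : ℕ) (g : S → ℝ) :
    (∑ τ : Fin (T + 1) → S × (∀ i, A i), g (τ 0).1 * G.tailWeight x T τ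
      = ∑ s, g s * ((G.step i η x ^ T) (G.terminal i η x) s).1) ∧
    (∑ τ : Fin (T + 1) → S × (∀ i, A i), g (τ 0).1 * G.tailWeight x T τ *
        (η * ∑ t, G.reward i (τ t).1 (τ t).2)
      = ∑ s, g s * ((G.step i η x ^ T) (G.terminal i η x) s).2) := by
  induction T generalizing g with
  | zero =>
    have hsum : ∀ F : (Fin 1 → S × (∀ i, A i)) → ℝ,
        ∑ τ, F τ = ∑ s, ∑ a, F fun _ => (s, a) := fun F => by
      rw [← (Equiv.funUnique (Fin 1) (S × (∀ i, A i))).symm.sum_comp, Fintype.sum_prod_type]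
      rfl
    rw [hsum, hsum]
    simp only [tailWeight, terminal, Finset.mul_sum, pow_zero, one_apply_eq_self]
    constructor
    · refine Finset.sum_congr rfl fun s _ => Finset.sum_congr rfl fun a _ => ?_
      simp
    · refine Finset.sum_congr rfl fun s _ => Finset.sum_congr rfl fun a _ => ?_
      simp
      ring
  | succ T ih =>
    set f := (G.step i η x ^ T) (G.terminal i η x) with hf
    have hpow : (G.step i η x ^ (T + 1)) (G.terminal i η x) = G.step i η x f := by
      rw [pow_succ', mul_apply_eq_comp]
    rw [hpow, sum_trajectories_succ, sum_trajectories_succ]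
    have hfirst : ∀ s a, ∑ τ : Fin (T + 1) → S × (∀ i, A i),
        G.trans s a (τ 0).1 * G.tailWeight x T τ = ∑ s', G.trans s a s' * (f s').1 :=
      fun s a => (ih (G.trans s a)).1
    have hsecond : ∀ s a, ∑ τ : Fin (T + 1) → S × (∀ i, A i),
        G.trans s a (τ 0).1 * G.tailWeight x T τ * (η * ∑ t, G.reward i (τ t).1 (τ t).2)
          = ∑ s', G.trans s a s' * (f s').2 :=
      fun s a => (ih (G.trans s a)).2
    constructor
    · refine Finset.sum_congr rfl fun s _ => ?_
      rw [step_apply, Finset.mul_sum]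
      refine Finset.sum_congr rfl fun a _ => ?_
      calc _ = g s * actionWeight x s a * ∑ τ : Fin (T + 1) → S × (∀ i, A i),
            G.trans s a (τ 0).1 * G.tailWeight x T τ := by
            rw [Finset.mul_sum]
            refine Finset.sum_congr rfl fun τ _ => ?_
            rw [tailWeight_cons, Fin.cons_zero]
            ring
        _ = _ := by
            rw [hfirst, Finset.mul_sum, Finset.mul_sum]
            refine Finset.sum_congr rfl fun s' _ => ?_
            ring
    · refine Finset.sum_congr rfl fun s _ => ?_
      rw [step_apply, Finset.mul_sum]
      refine Finset.sum_congr rfl fun a _ => ?_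
      calc _ = g s * actionWeight x s a * (∑ τ : Fin (T + 1) → S × (∀ i, A i),
            G.trans s a (τ 0).1 * G.tailWeight x T τ * (η * ∑ t, G.reward i (τ t).1 (τ t).2)
            + η * G.reward i s a * ∑ τ : Fin (T + 1) → S × (∀ i, A i),
            G.trans s a (τ 0).1 * G.tailWeight x T τ) := by
            rw [Finset.mul_sum (a := η * G.reward i s a), ← Finset.sum_add_distrib,
              Finset.mul_sum]
            refine Finset.sum_congr rfl fun τ _ => ?_
            rw [tailWeight_cons, Fin.cons_zero, Fin.sum_univ_succ (n := T + 1)]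
            simp only [Fin.cons_zero, Fin.cons_succ]
            ring
        _ = _ := by
            rw [hfirst, hsecond, Finset.mul_sum (a := η * G.reward i s a),
              ← Finset.sum_add_distrib, Finset.mul_sum, Finset.mul_sum]
            refine Finset.sum_congr rfl fun s' _ => ?_
            ring

/-- Where `step` is a contraction, the value is given by its Neumann series. -/
theorem value_eq_inverse (G : StochasticGame ι S A) (i : ι) {η : ℝ} (hη : η ≠ 0)
    {x : ProfileSpace ι S A} (hx : ‖G.step i η x‖ < 1) :
    G.value i x = η⁻¹ * ∑ s, G.init s *
      (Ring.inverse (1 - G.step i η x) (G.terminal i η x) s).2 := by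
  have hsum := hasSum_geom_series_inverse (G.step i η x) hx
  have hsum2 : HasSum (fun T : ℕ => (G.step i η x ^ T) (G.terminal i η x))
      (Ring.inverse (1 - G.step i η x) (G.terminal i η x)) :=
    (ContinuousLinearMap.apply ℝ (S → ℝ × ℝ) (G.terminal i η x)).hasSum hsum
  have hsum3 : HasSum (fun T : ℕ => η⁻¹ * ∑ s, G.init s *
      ((G.step i η x ^ T) (G.terminal i η x) s).2) (η⁻¹ * ∑ s, G.init s *
      (Ring.inverse (1 - G.step i η x) (G.terminal i η x) s).2) := by
    refine HasSum.mul_left _ (hasSum_sum fun s _ => HasSum.mul_left _ ?_)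
    exact ((ContinuousLinearMap.snd ℝ ℝ ℝ) ∘L
      ContinuousLinearMap.proj (R := ℝ) (φ := fun _ : S => ℝ × ℝ) s).hasSum hsum2
  rw [← hsum3.tsum_eq]
  refine tsum_congr fun T => ?_
  rw [← (G.sum_tailWeight i x T G.init).2, Finset.mul_sum]
  refine Finset.sum_congr rfl fun τ _ => ?_
  have : G.trajWeight x T τ = G.init (τ 0).1 * G.tailWeight x T τ := by
    simp only [trajWeight, tailWeight, actionWeight]
    ring
  rw [this]
  field_simp

theorem contDiffAt_value (G : StochasticGame ι S A) (i : ι) {x : ProfileSpace ι S A}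
    (hx : x ∈ policySet ι S A) {n : WithTop ℕ∞} : ContDiffAt ℝ n (G.value i) x := by
  obtain ⟨η, hη, hnorm⟩ := G.exists_norm_step_lt_one i
  have hstep : ContDiff ℝ n (G.step i η) := G.contDiff_step i η
  have hev : ∀ᶠ y in 𝓝 x, ‖G.step i η y‖ < 1 :=
    (hstep.continuous.norm.tendsto x).eventually_lt_const (hnorm x hx)
  refine ContDiffAt.congr_of_eventuallyEq ?_ (hev.mono fun y hy => G.value_eq_inverse i hη.ne' hy)
  have hinv : ContDiffAt ℝ n (fun y => Ring.inverse (1 - G.step i η y)) x := by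
    have := contDiffAt_ringInverse ℝ (n := n) (Units.oneSub (G.step i η x) (hnorm x hx))
    exact this.comp x (contDiffAt_const.sub hstep.contDiffAt)
  have happ : ContDiffAt ℝ n
      (fun y => Ring.inverse (1 - G.step i η y) (G.terminal i η y)) x :=
    hinv.clm_apply (G.contDiff_terminal i η).contDiffAt
  refine contDiffAt_const.mul (ContDiffAt.sum fun s _ => contDiffAt_const.mul ?_)
  exact contDiff_snd.contDiffAt.comp x (contDiffAt_pi.1 happ s)

theorem continuousAt_gradField (G : StochasticGame ι S A) {x : ProfileSpace ι S A}
    (hx : x ∈ policySet ι S A) : ContinuousAt G.gradField x := by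
  refine (PiLp.continuous_toLp 2 _).continuousAt.comp (continuousAt_pi.2 fun j => ?_)
  have hgrad : ContinuousAt (gradient (G.value j.1)) x :=
    (InnerProductSpace.toDual ℝ _).symm.continuous.continuousAt.comp
      ((G.contDiffAt_value j.1 hx (n := 1)).continuousAt_fderiv one_ne_zero)
  exact (EuclideanSpace.proj (𝕜 := ℝ) j).continuous.continuousAt.comp hgrad

end StochasticGame

section PolicySet

variable {ι : Type u} {S : Type v} {A : ι → Type w} [∀ i, Fintype (A i)]

theorem convex_policySet : Convex ℝ (policySet ι S A) := by
  intro x hx y hy a b ha hb hab i s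
  exact convex_stdSimplex ℝ (A i) (hx i s) (hy i s) ha hb hab

theorem isCompact_policySet [Fintype ι] [Fintype S] : IsCompact (policySet ι S A) := by
  refine Metric.isCompact_of_isClosed_isBounded ?_ ?_
  · have : policySet ι S A = ⋂ i, ⋂ s,
        (fun (x : ProfileSpace ι S A) (a : A i) => x ⟨i, (s, a)⟩) ⁻¹' stdSimplex ℝ (A i) := by
      ext x; simp [policySet]
    rw [this]
    refine isClosed_iInter fun i => isClosed_iInter fun s =>
      (isClosed_stdSimplex ℝ (A i)).preimage ?_
    fun_prop
  · refine (Metric.isBounded_iff_subset_closedBall 0).2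
      ⟨√(∑ _ : (Σ i, S × A i), (1 : ℝ)), fun x hx => ?_⟩
    rw [mem_closedBall_zero_iff, EuclideanSpace.norm_eq]
    refine Real.sqrt_le_sqrt (Finset.sum_le_sum fun j _ => ?_)
    have h := mem_Icc_of_mem_stdSimplex (hx j.1 j.2.1) j.2.2
    rw [Real.norm_eq_abs, sq_abs]
    exact pow_le_one₀ h.1 h.2

end PolicySet

/-! ### Euclidean projections -/

section Projection

variable {E : Type*} [NormedAddCommGroup E] [InnerProductSpace ℝ E] {K : Set E} {a k u x y z : E}

theorem IsEuclideanProj.inner_le_zero (hK : Convex ℝ K) (h : IsEuclideanProj K z y)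
    (hk : k ∈ K) : ⟪z - y, k - y⟫ ≤ 0 := by
  refine (norm_eq_iInf_iff_real_inner_le_zero hK h.1).1 (le_antisymm ?_ ?_) k hk
  · have : Nonempty K := ⟨⟨y, h.1⟩⟩
    exact le_ciInf fun w => h.2 w w.2
  · exact ciInf_le ⟨0, by rintro _ ⟨w, rfl⟩; exact norm_nonneg _⟩ (⟨y, h.1⟩ : K)

theorem IsEuclideanProj.norm_sub_le (hK : Convex ℝ K) (h : IsEuclideanProj K z y)
    (hk : k ∈ K) : ‖y - k‖ ≤ ‖z - k‖ := by
  have h1 := h.inner_le_zero hK hk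
  have h2 : ‖z - k‖ ^ 2 = ‖z - y‖ ^ 2 - 2 * ⟪z - y, k - y⟫ + ‖k - y‖ ^ 2 := by
    rw [← norm_sub_sq_real]
    congr 2
    abel
  rw [norm_sub_rev y k]
  refine le_of_sq_le_sq ?_ (norm_nonneg _)
  nlinarith [sq_nonneg ‖z - y‖]

theorem IsEuclideanProj.norm_sub_sq_le_of_add_smul (hK : Convex ℝ K) {c : ℝ}
    (h : IsEuclideanProj K (a + c • u) y) (hx : x ∈ K) :
    ‖y - x‖ ^ 2 - ‖a - x‖ ^ 2 ≤ 2 * c * ⟪u, a - x⟫ + c ^ 2 * ‖u‖ ^ 2 := by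
  have h1 := pow_le_pow_left₀ (norm_nonneg _) (h.norm_sub_le hK hx) 2
  have h2 : ‖a + c • u - x‖ ^ 2 = ‖a - x‖ ^ 2 + 2 * (c * ⟪u, a - x⟫) + c ^ 2 * ‖u‖ ^ 2 := by
    rw [show a + c • u - x = (a - x) + c • u by abel, norm_add_sq_real, inner_smul_right,
      real_inner_comm, norm_smul, mul_pow, Real.norm_eq_abs, sq_abs]
  linarith

theorem IsEuclideanProj.sq_norm_sub_sq_le_of_add_smul (hK : Convex ℝ K) {c D : ℝ}
    (h : IsEuclideanProj K (a + c • u) y) (ha : a ∈ K) (hD : ∀ k ∈ K, ‖k - x‖ ≤ D) :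
    (‖y - x‖ ^ 2 - ‖a - x‖ ^ 2) ^ 2 ≤ 4 * D ^ 2 * c ^ 2 * ‖u‖ ^ 2 := by
  have h1 : ‖y - a‖ ≤ |c| * ‖u‖ := by
    simpa [norm_smul] using h.norm_sub_le hK ha
  have h2 : |‖y - x‖ - ‖a - x‖| ≤ |c| * ‖u‖ := by
    refine (abs_norm_sub_norm_le _ _).trans ?_
    simpa using h1
  have h3 : (‖y - x‖ - ‖a - x‖) ^ 2 ≤ c ^ 2 * ‖u‖ ^ 2 := by
    rw [← sq_abs, ← sq_abs c, ← mul_pow]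
    exact pow_le_pow_left₀ (abs_nonneg _) h2 2
  have h4 : (‖y - x‖ + ‖a - x‖) ^ 2 ≤ 4 * D ^ 2 := by
    rw [show 4 * D ^ 2 = (D + D) ^ 2 by ring]
    exact pow_le_pow_left₀ (by positivity) (add_le_add (hD y h.1) (hD a ha)) 2
  calc (‖y - x‖ ^ 2 - ‖a - x‖ ^ 2) ^ 2
      = (‖y - x‖ + ‖a - x‖) ^ 2 * (‖y - x‖ - ‖a - x‖) ^ 2 := by ring
    _ ≤ 4 * D ^ 2 * (c ^ 2 * ‖u‖ ^ 2) := mul_le_mul h4 h3 (sq_nonneg _) (by positivity)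
    _ = _ := by ring

end Projection

/-! ### One step of a projected stochastic gradient method -/

section OneStep

theorem integrable_norm_sq {E Ω : Type*} [NormedAddCommGroup E] {m0 : MeasurableSpace Ω}
    {μ : Measure Ω} {Y : Ω → E} (hY : MemLp Y 2 μ) : Integrable (fun ω => ‖Y ω‖ ^ 2) μ :=
  hY.norm.integrable_sq

variable {E : Type*} [NormedAddCommGroup E] [InnerProductSpace ℝ E]
  {Ω : Type*} {m m0 : MeasurableSpace Ω} {μ : Measure Ω}
  {K : Set E} {x : E} {X X' Y V : Ω → E} {c B C D Q σ : ℝ}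

/-- The conditional second moment of the increment of the squared distance to `x`. The diameter
of `K` enters as projecting moves the point by no more than the step that was taken. -/
theorem ae_condExp_sq_norm_sub_sq_le (hK : Convex ℝ K)
    (hXm : AEStronglyMeasurable X μ) (hX'm : AEStronglyMeasurable X' μ)
    (hXK : ∀ ω, X ω ∈ K) (hD : ∀ k ∈ K, ‖k - x‖ ≤ D) (hY : MemLp Y 2 μ)
    (hX' : ∀ ω, IsEuclideanProj K (X ω + c • Y ω) (X' ω))
    (hQ : ∀ᵐ ω ∂μ, (μ[fun ω' => ‖Y ω'‖ ^ 2 | m]) ω ≤ Q) :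
    ∀ᵐ ω ∂μ, (μ[fun ω' => (‖X' ω' - x‖ ^ 2 - ‖X ω' - x‖ ^ 2) ^ 2 | m]) ω
      ≤ 4 * D ^ 2 * c ^ 2 * Q := by
  have hY2 := integrable_norm_sq hY
  have hle : ∀ ω, (‖X' ω - x‖ ^ 2 - ‖X ω - x‖ ^ 2) ^ 2 ≤ 4 * D ^ 2 * c ^ 2 * ‖Y ω‖ ^ 2 :=
    fun ω => (hX' ω).sq_norm_sub_sq_le_of_add_smul hK (hXK ω) hD
  have hint : Integrable (fun ω => (‖X' ω - x‖ ^ 2 - ‖X ω - x‖ ^ 2) ^ 2) μ := by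
    refine (hY2.const_mul (4 * D ^ 2 * c ^ 2)).mono' ?_ (ae_of_all _ fun ω => ?_)
    · exact ((((hX'm.sub aestronglyMeasurable_const).norm.pow 2).sub
        ((hXm.sub aestronglyMeasurable_const).norm.pow 2)).pow 2)
    · rw [Real.norm_eq_abs, abs_of_nonneg (sq_nonneg _)]
      exact hle ω
  filter_upwards [condExp_mono (m := m) hint (hY2.smul (4 * D ^ 2 * c ^ 2)) (ae_of_all μ hle), hQ,
    condExp_smul (μ := μ) (4 * D ^ 2 * c ^ 2) (fun ω => ‖Y ω‖ ^ 2) m] with ω h1 h2 h3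
  rw [h3, Pi.smul_apply, smul_eq_mul] at h1
  exact h1.trans (mul_le_mul_of_nonneg_left h2 (by positivity))

variable [CompleteSpace E] [IsProbabilityMeasure μ]

/-- A bound on the bias of a signal `Y` and on its noise bound its conditional second moment. -/
theorem ae_condExp_norm_sq_le (hm : m ≤ m0) (hY : MemLp Y 2 μ)
    (hVC : ∀ ω, ‖V ω‖ ≤ C) (hB : ∀ᵐ ω ∂μ, ‖(μ[Y | m]) ω - V ω‖ ≤ B)
    (hσ : ∀ᵐ ω ∂μ, (μ[fun ω' => ‖Y ω' - (μ[Y | m]) ω'‖ ^ 2 | m]) ω ≤ σ ^ 2) :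
    ∀ᵐ ω ∂μ, (μ[fun ω' => ‖Y ω'‖ ^ 2 | m]) ω ≤ 2 * (C + B) ^ 2 + 2 * σ ^ 2 := by
  have hU : Integrable (fun ω => ‖Y ω - (μ[Y | m]) ω‖ ^ 2) μ :=
    integrable_norm_sq (hY.sub (hY.condExp one_le_two))
  have hg : ∀ᵐ ω ∂μ, ‖(μ[Y | m]) ω‖ ≤ C + B := by
    filter_upwards [hB] with ω hω
    have := norm_sub_norm_le ((μ[Y | m]) ω) (V ω)
    linarith [hVC ω]
  have hle : (fun ω => ‖Y ω‖ ^ 2) ≤ᵐ[μ]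
      (fun _ => 2 * (C + B) ^ 2) + (2 : ℝ) • fun ω => ‖Y ω - (μ[Y | m]) ω‖ ^ 2 := by
    filter_upwards [hg] with ω hω
    have h1 : ‖Y ω‖ ≤ ‖Y ω - (μ[Y | m]) ω‖ + (C + B) := by
      have := norm_sub_norm_le (Y ω) ((μ[Y | m]) ω)
      linarith
    have h2 := pow_le_pow_left₀ (norm_nonneg _) h1 2
    simp only [Pi.add_apply, Pi.smul_apply, smul_eq_mul]
    nlinarith [sq_nonneg (‖Y ω - (μ[Y | m]) ω‖ - (C + B))]
  filter_upwards [condExp_mono (m := m) (integrable_norm_sq hY)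
      ((integrable_const _).add (hU.smul (2 : ℝ))) hle,
    condExp_add (μ := μ) (integrable_const (2 * (C + B) ^ 2)) (hU.smul (2 : ℝ)) m,
    condExp_smul (μ := μ) (2 : ℝ) (fun ω => ‖Y ω - (μ[Y | m]) ω‖ ^ 2) m, hσ] with ω h1 h2 h3 h4
  rw [h2, Pi.add_apply, h3, condExp_const hm, Pi.smul_apply, smul_eq_mul] at h1
  linarith

/-- The conditional drift of the squared distance to `x`: the field `V` contributes to first
order, the noise only to second order. -/
theorem ae_condExp_norm_sub_sq_le (hK : Convex ℝ K) (hx : x ∈ K)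
    (hXm : StronglyMeasurable[m] X) (hX'm : AEStronglyMeasurable X' μ) (hm : m ≤ m0)
    (hXK : ∀ ω, X ω ∈ K) (hD : ∀ k ∈ K, ‖k - x‖ ≤ D) (hc : 0 ≤ c) (hY : MemLp Y 2 μ)
    (hX' : ∀ ω, IsEuclideanProj K (X ω + c • Y ω) (X' ω))
    (hB : ∀ᵐ ω ∂μ, ‖(μ[Y | m]) ω - V ω‖ ≤ B)
    (hQ : ∀ᵐ ω ∂μ, (μ[fun ω' => ‖Y ω'‖ ^ 2 | m]) ω ≤ Q) :
    ∀ᵐ ω ∂μ, (μ[fun ω' => ‖X' ω' - x‖ ^ 2 - ‖X ω' - x‖ ^ 2 | m]) ω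
      ≤ 2 * c * ⟪V ω, X ω - x⟫ + 2 * c * B * D + c ^ 2 * Q := by
  have hbound : ∀ {F : Ω → E}, AEStronglyMeasurable F μ → (∀ ω, F ω ∈ K) →
      MemLp (fun ω => F ω - x) 2 μ := fun {F} hF hFK =>
    MemLp.of_bound (hF.sub aestronglyMeasurable_const) D (ae_of_all _ fun ω => hD _ (hFK ω))
  have hX2 := hbound (hXm.mono hm).aestronglyMeasurable hXK
  have hX'2 := hbound hX'm fun ω => (hX' ω).1
  have hinner : Integrable (fun ω => ⟪Y ω, X ω - x⟫) μ := by
    refine ((hY.integrable one_le_two).norm.mul_const D).mono' (hY.1.inner hX2.1)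
      (ae_of_all _ fun ω => (norm_inner_le_norm _ _).trans ?_)
    exact mul_le_mul_of_nonneg_left (hD _ (hXK ω)) (norm_nonneg _)
  have hpull : μ[fun ω => ⟪Y ω, X ω - x⟫ | m] =ᵐ[μ] fun ω => ⟪(μ[Y | m]) ω, X ω - x⟫ :=
    condExp_bilin_of_stronglyMeasurable_right (innerSL ℝ)
      (hXm.sub stronglyMeasurable_const) hinner (hY.integrable one_le_two)
  have hY2 := integrable_norm_sq hY
  have hmono := condExp_mono (m := m)
    ((integrable_norm_sq hX'2).sub (integrable_norm_sq hX2))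
    ((hinner.smul (2 * c)).add (hY2.smul (c ^ 2)))
    (ae_of_all μ fun ω => (hX' ω).norm_sub_sq_le_of_add_smul hK hx)
  filter_upwards [hmono, hpull, hB, hQ,
    condExp_add (μ := μ) (hinner.smul (2 * c)) (hY2.smul (c ^ 2)) m,
    condExp_smul (μ := μ) (2 * c) (fun ω => ⟪Y ω, X ω - x⟫) m,
    condExp_smul (μ := μ) (c ^ 2) (fun ω => ‖Y ω‖ ^ 2) m] with ω h1 h2 h3 h4 h5 h6 h7
  rw [h5, Pi.add_apply, h6, h7, Pi.smul_apply, Pi.smul_apply, h2, smul_eq_mul, smul_eq_mul] at h1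
  refine h1.trans ?_
  have h8 : ⟪(μ[Y | m]) ω, X ω - x⟫ = ⟪V ω, X ω - x⟫ + ⟪(μ[Y | m]) ω - V ω, X ω - x⟫ := by
    rw [← inner_add_left]
    congr 1
    abel
  have h9 : ⟪(μ[Y | m]) ω - V ω, X ω - x⟫ ≤ B * D :=
    (real_inner_le_norm _ _).trans (mul_le_mul h3 (hD _ (hXK ω)) (norm_nonneg _)
      ((norm_nonneg _).trans h3))
  have h10 := mul_le_mul_of_nonneg_left h9 (by positivity : 0 ≤ 2 * c)
  have h11 := mul_le_mul_of_nonneg_left h4 (sq_nonneg c)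
  rw [h8]
  linarith

end OneStep

section History

variable {Ω E : Type*} [MeasurableSpace E]

theorem measurable_history (X : ℕ → Ω → E) {k n : ℕ} (hk : k ∈ Set.Icc 1 n) :
    Measurable[history X n] (X k) :=
  measurable_iff_comap_le.2 (le_iSup₂_of_le k hk le_rfl)

theorem history_mono (X : ℕ → Ω → E) : Monotone (history X) := fun _ _ h =>
  biSup_mono fun _ hk => ⟨hk.1, hk.2.trans h⟩

theorem history_le [MeasurableSpace Ω] {X : ℕ → Ω → E} (hX : ∀ n, 1 ≤ n → Measurable (X n))
    (n : ℕ) : history X n ≤ ‹MeasurableSpace Ω› :=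
  iSup₂_le fun k hk => measurable_iff_comap_le.1 (hX k hk.1)

/-- The histories of a process whose first stage has index `1`, as a filtration over `ℕ`. -/
def historyFiltration [MeasurableSpace Ω] {X : ℕ → Ω → E}
    (hX : ∀ n, 1 ≤ n → Measurable (X n)) : Filtration ℕ ‹MeasurableSpace Ω› where
  seq n := history X (n + 1)
  mono' _ _ h := history_mono X (Nat.succ_le_succ h)
  le' n := history_le hX (n + 1)

end History

theorem stronglyMeasurable_comp_of_continuousOn {Ω E F : Type*} [MeasurableSpace Ω]
    [TopologicalSpace E] [MeasurableSpace E] [BorelSpace E] [SecondCountableTopology E]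
    [TopologicalSpace F] [TopologicalSpace.PseudoMetrizableSpace F]
    {K : Set E} {f : E → F} (hf : ContinuousOn f K) {X : Ω → E} (hX : Measurable X)
    (hXK : ∀ ω, X ω ∈ K) : StronglyMeasurable fun ω => f (X ω) :=
  (continuousOn_iff_continuous_domRestrict.1 hf).stronglyMeasurable.comp_measurable
    (hX.subtype_mk (h := hXK))

/-! ### Step sizes -/

/-- The step size at stage `n`. -/
noncomputable def stepSize (γ m p : ℝ) (n : ℕ) : ℝ := γ / ((n : ℝ) + m) ^ p

/-- The size of the perturbation of stage `n`: up to a constant factor, it bounds the contributions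
of the bias, the noise and the discretization to the drift of the squared distance to the target,
and the conditional second moment of the increment of this squared distance. -/
noncomputable def stepError (γ m p : ℝ) (B σ : ℕ → ℝ) (n : ℕ) : ℝ :=
  stepSize γ m p n * |B n| + stepSize γ m p n ^ 2 * (1 + B n ^ 2 + σ n ^ 2)

section StepSize

variable {γ m p lb ls : ℝ} {B σ : ℕ → ℝ}

theorem stepSize_nonneg (hγ : 0 ≤ γ) (hm : 0 ≤ m) (n : ℕ) : 0 ≤ stepSize γ m p n := by
  unfold stepSize; positivity

theorem stepError_nonneg (hγ : 0 ≤ γ) (hm : 0 ≤ m) (n : ℕ) : 0 ≤ stepError γ m p B σ n := by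
  have := stepSize_nonneg (p := p) hγ hm n
  unfold stepError; positivity

theorem stepSize_le (hγ : 0 ≤ γ) (hm : 0 ≤ m) (hp : 0 ≤ p) (n : ℕ) :
    stepSize γ m p (n + 1) ≤ γ * ((n + 1 : ℕ) : ℝ) ^ (-p) := by
  unfold stepSize
  rw [Real.rpow_neg (Nat.cast_nonneg _), ← div_eq_mul_inv]
  have : (0 : ℝ) < ((n + 1 : ℕ) : ℝ) := by positivity
  gcongr
  linarith

theorem not_summable_stepSize (hγ : 0 < γ) (hm : 0 ≤ m) (hp1 : p ≤ 1) :
    ¬ Summable fun n => stepSize γ m p (n + 1) := by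
  intro h
  have hle : ∀ n : ℕ, γ / (1 + m) * (1 / ((n + 1 : ℕ) : ℝ)) ≤ stepSize γ m p (n + 1) := fun n => by
    have hn : (1 : ℝ) ≤ ((n + 1 : ℕ) : ℝ) := by
      exact_mod_cast Nat.succ_le_succ (Nat.zero_le n)
    have hle1 : (((n + 1 : ℕ) : ℝ) + m) ^ p ≤ (1 + m) * ((n + 1 : ℕ) : ℝ) :=
      calc (((n + 1 : ℕ) : ℝ) + m) ^ p ≤ (((n + 1 : ℕ) : ℝ) + m) ^ (1 : ℝ) :=
            Real.rpow_le_rpow_of_exponent_le (by linarith) hp1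
        _ = ((n + 1 : ℕ) : ℝ) + m := Real.rpow_one _
        _ ≤ _ := by nlinarith
    have hpos : 0 < (((n + 1 : ℕ) : ℝ) + m) ^ p := by positivity
    rw [div_mul_div_comm, mul_one]
    exact div_le_div_of_nonneg_left hγ.le hpos hle1
  have hs : Summable fun n : ℕ => γ / (1 + m) * (1 / ((n + 1 : ℕ) : ℝ)) :=
    Summable.of_nonneg_of_le (fun n => by positivity) hle h
  rw [summable_mul_left_iff (by positivity)] at hs
  exact Real.not_summable_one_div_natCast ((summable_nat_add_iff 1).1 hs)

theorem summable_rpow_neg_mul_of_isBigO {f : ℕ → ℝ} {q a : ℝ}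
    (hf : f =O[atTop] fun n : ℕ => (n : ℝ) ^ a) (h : 1 < q - a) :
    Summable fun n : ℕ => (n : ℝ) ^ (-q) * f n := by
  refine summable_of_isBigO_nat (g := fun n : ℕ => (n : ℝ) ^ (-q + a))
    (Real.summable_nat_rpow.2 (by linarith)) ?_
  refine ((isBigO_refl (fun n : ℕ => (n : ℝ) ^ (-q)) atTop).mul hf).congr' EventuallyEq.rfl ?_
  filter_upwards [eventually_gt_atTop 0] with n hn
  rw [Real.rpow_add (by exact_mod_cast hn)]

theorem isBigO_sq_rpow {f : ℕ → ℝ} {a : ℝ} (hf : f =O[atTop] fun n : ℕ => (n : ℝ) ^ a) :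
    (fun n => f n ^ 2) =O[atTop] fun n : ℕ => (n : ℝ) ^ (2 * a) := by
  refine (hf.pow 2).congr_right fun n => ?_
  rw [mul_comm, Real.rpow_mul (Nat.cast_nonneg n), Real.rpow_two]

theorem summable_rpow_neg_mul_abs (hlb : 1 < p + lb)
    (hB : B =O[atTop] fun n : ℕ => (n : ℝ) ^ (-lb)) :
    Summable fun n : ℕ => ((n + 1 : ℕ) : ℝ) ^ (-p) * |B (n + 1)| :=
  (summable_nat_add_iff 1).2 (summable_rpow_neg_mul_of_isBigO hB.abs_left (by linarith))

theorem summable_rpow_neg_sq_mul (hp : 1 / 2 < p) (hlb : 1 < p + lb) (hls : 1 / 2 < p - ls)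
    (hB : B =O[atTop] fun n : ℕ => (n : ℝ) ^ (-lb))
    (hσ : σ =O[atTop] fun n : ℕ => (n : ℝ) ^ ls) :
    Summable fun n : ℕ =>
      (((n + 1 : ℕ) : ℝ) ^ (-p)) ^ 2 * (1 + B (n + 1) ^ 2 + σ (n + 1) ^ 2) := by
  have h1 : Summable fun n : ℕ => (n : ℝ) ^ (-(2 * p)) * 1 :=
    summable_rpow_neg_mul_of_isBigO (a := 0)
      (by simpa using isBigO_refl (fun _ : ℕ => (1 : ℝ)) atTop) (by linarith)
  have h2 := summable_rpow_neg_mul_of_isBigO (q := 2 * p) (isBigO_sq_rpow hB) (by linarith)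
  have h3 := summable_rpow_neg_mul_of_isBigO (q := 2 * p) (isBigO_sq_rpow hσ) (by linarith)
  refine (summable_nat_add_iff (f := fun n : ℕ =>
    ((n : ℝ) ^ (-p)) ^ 2 * (1 + B n ^ 2 + σ n ^ 2)) 1).2 (((h1.add h2).add h3).congr fun n => ?_)
  have : ((n : ℝ) ^ (-p)) ^ 2 = (n : ℝ) ^ (-(2 * p)) := by
    rw [← Real.rpow_two, ← Real.rpow_mul (Nat.cast_nonneg n)]
    congr 1
    ring
  rw [this]
  ring

theorem stepError_le (hγ : 0 ≤ γ) (hm : 0 ≤ m) (hp : 0 ≤ p) (n : ℕ) :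
    stepError γ m p B σ (n + 1) ≤ γ * (((n + 1 : ℕ) : ℝ) ^ (-p) * |B (n + 1)|) +
      γ ^ 2 * ((((n + 1 : ℕ) : ℝ) ^ (-p)) ^ 2 * (1 + B (n + 1) ^ 2 + σ (n + 1) ^ 2)) := by
  have h := stepSize_le hγ hm hp n
  have h0 := stepSize_nonneg (p := p) hγ hm (n + 1)
  rw [← mul_assoc, ← mul_assoc, ← mul_pow]
  unfold stepError
  gcongr

theorem tendsto_stepSize_atTop (hp : 0 < p) (n : ℕ) :
    Tendsto (fun m => stepSize γ m p n) atTop (𝓝 0) :=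
  ((tendsto_rpow_atTop hp).comp (tendsto_atTop_add_const_left _ _ tendsto_id)).const_div_atTop γ

/-- The total error is finite, and small if `γ` is small or `m` is large. -/
theorem summable_and_tsum_stepError_le (hp : 1 / 2 < p) (hlb : 1 < p + lb) (hls : 1 / 2 < p - ls)
    (hB : B =O[atTop] fun n : ℕ => (n : ℝ) ^ (-lb))
    (hσ : σ =O[atTop] fun n : ℕ => (n : ℝ) ^ ls) {η : ℝ} (hη : 0 < η) :
    (∀ γ m : ℝ, 0 < γ → 0 ≤ m → Summable fun n => stepError γ m p B σ (n + 1)) ∧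
    (∃ γ₀ : ℝ, 0 < γ₀ ∧ ∀ γ m : ℝ, 0 < γ → γ ≤ γ₀ → 0 ≤ m →
      ∑' n, stepError γ m p B σ (n + 1) ≤ η) ∧
    (∀ γ : ℝ, 0 < γ → ∃ m₀ : ℝ, 0 ≤ m₀ ∧ ∀ m : ℝ, m₀ ≤ m →
      ∑' n, stepError γ m p B σ (n + 1) ≤ η) := by
  have hf := summable_rpow_neg_mul_abs hlb hB
  have hg := summable_rpow_neg_sq_mul hp hlb hls hB hσ
  set f : ℕ → ℝ := fun n => ((n + 1 : ℕ) : ℝ) ^ (-p) * |B (n + 1)| with hf_def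
  set g : ℕ → ℝ := fun n =>
    (((n + 1 : ℕ) : ℝ) ^ (-p)) ^ 2 * (1 + B (n + 1) ^ 2 + σ (n + 1) ^ 2) with hg_def
  have hp0 : 0 < p := by linarith
  have hdom : ∀ γ : ℝ, Summable fun n => γ * f n + γ ^ 2 * g n := fun γ =>
    (hf.mul_left γ).add (hg.mul_left (γ ^ 2))
  have hsum : ∀ γ m : ℝ, 0 < γ → 0 ≤ m → Summable fun n => stepError γ m p B σ (n + 1) :=
    fun γ m hγ hm => Summable.of_nonneg_of_le (fun n => stepError_nonneg hγ.le hm (n + 1))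
      (stepError_le hγ.le hm hp0.le) (hdom γ)
  refine ⟨hsum, ?_, fun γ hγ => ?_⟩
  · have hF : 0 ≤ ∑' n, f n := tsum_nonneg fun n => by positivity
    have hG : 0 ≤ ∑' n, g n := tsum_nonneg fun n => by positivity
    have hlim : Tendsto (fun γ : ℝ => γ * ∑' n, f n + γ ^ 2 * ∑' n, g n) (𝓝[>] 0) (𝓝 0) := by
      have : Continuous fun γ : ℝ => γ * ∑' n, f n + γ ^ 2 * ∑' n, g n := by fun_prop
      exact (this.tendsto' 0 0 (by simp)).mono_left nhdsWithin_le_nhds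
    obtain ⟨γ₀, hγ₀, hγ₀pos⟩ :=
      ((hlim.eventually_lt_const hη).and self_mem_nhdsWithin).exists
    have hγ₀pos : (0 : ℝ) < γ₀ := hγ₀pos
    refine ⟨γ₀, hγ₀pos, fun γ m hγ hle hm => ?_⟩
    calc ∑' n, stepError γ m p B σ (n + 1)
        ≤ ∑' n, (γ * f n + γ ^ 2 * g n) :=
          (hsum γ m hγ hm).tsum_le_tsum (stepError_le hγ.le hm hp0.le) (hdom γ)
      _ = γ * ∑' n, f n + γ ^ 2 * ∑' n, g n := by
          rw [(hf.mul_left γ).tsum_add (hg.mul_left (γ ^ 2)), tsum_mul_left, tsum_mul_left]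
      _ ≤ γ₀ * ∑' n, f n + γ₀ ^ 2 * ∑' n, g n := by gcongr
      _ ≤ η := hγ₀.le
  · have hlim : Tendsto (fun m => ∑' n, stepError γ m p B σ (n + 1)) atTop (𝓝 (∑' _ : ℕ, 0)) := by
      refine tendsto_tsum_of_dominated_convergence (hdom γ) (fun n => ?_) ?_
      · have h := tendsto_stepSize_atTop (γ := γ) hp0 (n + 1)
        simpa [stepError] using (h.mul_const |B (n + 1)|).add
          ((h.pow 2).mul_const (1 + B (n + 1) ^ 2 + σ (n + 1) ^ 2))
      · filter_upwards [eventually_ge_atTop 0] with m hm n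
        rw [Real.norm_eq_abs, abs_of_nonneg (stepError_nonneg hγ.le hm (n + 1))]
        exact stepError_le hγ.le hm hp0.le n
    rw [tsum_zero] at hlim
    obtain ⟨m₀, hm₀⟩ := eventually_atTop.1 (hlim.eventually_le_const hη)
    exact ⟨max m₀ 0, le_max_right _ _, fun m hm => hm₀ m ((le_max_left _ _).trans hm)⟩

end StepSize

/-! ### Local convergence -/

/-- For a sequence `X` in a compact set with convergent distance to `x`, a positive function can
only be summable with weights of infinite sum if `X` converges to `x`. -/
theorem tendsto_of_summable_mul {E : Type*} [NormedAddCommGroup E] {K : Set E} (hK : IsCompact K)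
    {x : E} {φ : E → ℝ} (hφ : ContinuousOn φ K) (hpos : ∀ y ∈ K, y ≠ x → 0 < φ y) {X : ℕ → E}
    (hX : ∀ n, X n ∈ K) {c : ℕ → ℝ} (hc0 : ∀ n, 0 ≤ c n) (hc : ¬ Summable c)
    (hsum : Summable fun n => c n * φ (X n)) {l : ℝ}
    (hl : Tendsto (fun n => ‖X n - x‖ ^ 2) atTop (𝓝 l)) : Tendsto X atTop (𝓝 x) := by
  have hl0 : 0 ≤ l := ge_of_tendsto' hl fun n => sq_nonneg _
  rcases hl0.eq_or_lt with rfl | hlpos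
  · rw [tendsto_iff_norm_sub_tendsto_zero]
    have := hl.sqrt
    simpa [Real.sqrt_sq (norm_nonneg _)] using this
  · exfalso
    set K' := K ∩ {y | l / 2 ≤ ‖y - x‖ ^ 2} with hK'
    have hK'c : IsCompact K' := hK.inter_right (isClosed_le continuous_const (by fun_prop))
    have hne : ∀ y ∈ K', y ≠ x := by
      rintro y ⟨-, hy⟩ rfl
      simp only [Set.mem_ofPred_eq, sub_self, norm_zero] at hy
      linarith
    have hev : ∀ᶠ n in atTop, X n ∈ K' :=
      (hl.eventually_const_le (by linarith : l / 2 < l)).mono fun n hn => ⟨hX n, hn⟩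
    obtain ⟨n₀, hn₀⟩ := hev.exists
    obtain ⟨y, hy, hmin⟩ := hK'c.exists_isMinOn ⟨_, hn₀⟩ (hφ.mono Set.inter_subset_left)
    have hφy : 0 < φ y := hpos y hy.1 (hne y hy)
    refine hc ((hsum.mul_right (φ y)⁻¹).of_norm_bounded_eventually_nat ?_)
    filter_upwards [hev] with n hn
    rw [Real.norm_eq_abs, abs_of_nonneg (hc0 n), mul_assoc]
    refine le_mul_of_one_le_right (hc0 n) ?_
    rw [← div_eq_mul_inv, one_le_div hφy]
    exact hmin hn

namespace StochasticGame

variable {ι : Type u} {S : Type v} {A : ι → Type w}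
  [Fintype ι] [DecidableEq ι] [Fintype S] [∀ i, Fintype (A i)]
  {G : StochasticGame ι S A} {γ m p : ℝ} {B σ : ℕ → ℝ} {Ω : Type z} [MeasurableSpace Ω]
  {μ : Measure Ω} {X Y : ℕ → Ω → ProfileSpace ι S A} {x : ProfileSpace ι S A}

theorem continuousOn_gradField (G : StochasticGame ι S A) :
    ContinuousOn G.gradField (policySet ι S A) := fun _ hy =>
  (G.continuousAt_gradField hy).continuousWithinAt

theorem IsPolicyGradient.mem_policySet (h : G.IsPolicyGradient γ m p B σ μ X Y) {n : ℕ}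
    (hn : 1 ≤ n) (ω : Ω) : X n ω ∈ policySet ι S A := by
  induction n, hn using Nat.le_induction with
  | base => exact h.init_mem ω
  | succ n hn _ => exact (h.update n hn ω).1

theorem IsPolicyGradient.stronglyMeasurable_gradField (h : G.IsPolicyGradient γ m p B σ μ X Y)
    {n : ℕ} (hn : 1 ≤ n) : StronglyMeasurable[history X n] fun ω => G.gradField (X n ω) :=
  @stronglyMeasurable_comp_of_continuousOn Ω _ _ (history X n) _ _ _ _ _ _ _ _
    G.continuousOn_gradField _ (measurable_history X ⟨hn, le_rfl⟩) (h.mem_policySet hn)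

/-- As the bias at stage `n` is a function of the history, its conditional mean bound is
a pointwise bound. -/
theorem IsPolicyGradient.ae_norm_bias_le [IsProbabilityMeasure μ]
    (h : G.IsPolicyGradient γ m p B σ μ X Y) {C : ℝ}
    (hC : ∀ y ∈ policySet ι S A, ‖G.gradField y‖ ≤ C) {n : ℕ} (hn : 1 ≤ n) :
    ∀ᵐ ω ∂μ, ‖(μ[Y n | history X n]) ω - G.gradField (X n ω)‖ ≤ B n := by
  have hle := history_le h.measurable n
  have hv := h.stronglyMeasurable_gradField hn
  have hbm : StronglyMeasurable[history X n] (G.bias μ X Y n) :=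
    stronglyMeasurable_condExp.sub hv
  have hint : Integrable (G.bias μ X Y n) μ :=
    integrable_condExp.sub (Integrable.of_bound (hv.mono hle).aestronglyMeasurable C
      (ae_of_all _ fun ω => hC _ (h.mem_policySet hn ω)))
  have heq := condExp_of_stronglyMeasurable hle hbm.norm hint.norm
  filter_upwards [h.bias_le n hn] with ω hω
  rw [heq] at hω
  exact hω

/-- A sequence of play that starts near `x` on an event `A` remains near `x` on `A`, and its distance
to `x` converges, up to a set of small relative probability. -/
theorem IsPolicyGradient.measureReal_diff_le [IsProbabilityMeasure μ]
    (h : G.IsPolicyGradient γ m p B σ μ X Y) (hγ : 0 < γ) (hm : 0 ≤ m)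
    (hx : x ∈ policySet ι S A) {r C D : ℝ} (hr : 0 < r)
    (hstable : ∀ y ∈ policySet ι S A, ‖y - x‖ ≤ r → ⟪G.gradField y, y - x⟫ ≤ 0)
    (hC : ∀ y ∈ policySet ι S A, ‖G.gradField y‖ ≤ C)
    (hD0 : 0 ≤ D) (hD : ∀ y ∈ policySet ι S A, ‖y - x‖ ≤ D) {k : ℝ}
    (hk : k = (1 + 2 * D + 4 * D ^ 2) * (4 * C ^ 2 + 4))
    (hsum : Summable fun n => stepError γ m p B σ (n + 1))
    (hsumr : k * ∑' n, stepError γ m p B σ (n + 1) ≤ r ^ 2 / 4)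
    {U : Set (ProfileSpace ι S A)} (hU : MeasurableSet U) (hUr : ∀ y ∈ U, ‖y - x‖ ≤ r / 2) :
    μ.real ({ω | X 1 ω ∈ U} \ {ω | (∀ n, ‖X (n + 1) ω - x‖ ^ 2 ≤ r ^ 2) ∧
        (∃ l, Tendsto (fun n => ‖X (n + 1) ω - x‖ ^ 2) atTop (𝓝 l)) ∧
        Summable fun n => 2 * stepSize γ m p (n + 1) *
          -⟪G.gradField (X (n + 1) ω), X (n + 1) ω - x⟫}) ≤
      4 * (k * ∑' n, stepError γ m p B σ (n + 1)) / (r ^ 2) ^ 2 * μ.real {ω | X 1 ω ∈ U} := by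
  have hXm : ∀ n, StronglyMeasurable[history X (n + 1)] (X (n + 1)) := fun n =>
    (measurable_history X ⟨n.succ_pos, le_rfl⟩).stronglyMeasurable
  have hle : ∀ n, history X (n + 1) ≤ ‹MeasurableSpace Ω› := fun n =>
    history_le h.measurable (n + 1)
  have hX0 : ∀ n, AEStronglyMeasurable (X (n + 1)) μ := fun n =>
    ((hXm n).mono (hle n)).aestronglyMeasurable
  have hXK : ∀ n ω, X (n + 1) ω ∈ policySet ι S A := fun n => h.mem_policySet n.succ_pos
  have hc0 : ∀ n, 0 ≤ stepSize γ m p n := stepSize_nonneg hγ.le hm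
  have hup : ∀ n ω, IsEuclideanProj (policySet ι S A)
      (X (n + 1) ω + stepSize γ m p (n + 1) • Y (n + 1) ω) (X (n + 2) ω) := fun n =>
    h.update (n + 1) n.succ_pos
  have hbias : ∀ n, ∀ᵐ ω ∂μ, ‖(μ[Y (n + 1) | history X (n + 1)]) ω - G.gradField (X (n + 1) ω)‖
      ≤ |B (n + 1)| := fun n => by
    filter_upwards [h.ae_norm_bias_le hC n.succ_pos] with ω hω
    exact hω.trans (le_abs_self _)
  have hQ := fun n => ae_condExp_norm_sq_le (hle n) (h.memLp (n + 1) n.succ_pos)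
    (fun ω => hC _ (hXK n ω)) (hbias n) (h.noise_le (n + 1) n.succ_pos)
  have hQle : ∀ n, 2 * (C + |B n|) ^ 2 + 2 * σ n ^ 2
      ≤ (4 * C ^ 2 + 4) * (1 + B n ^ 2 + σ n ^ 2) := fun n => by
    have h1 : (C + |B n|) ^ 2 ≤ 2 * C ^ 2 + 2 * B n ^ 2 := by
      nlinarith [sq_nonneg (C - |B n|), sq_abs (B n)]
    have h2 : 0 ≤ C ^ 2 * B n ^ 2 := by positivity
    have h3 : 0 ≤ C ^ 2 * σ n ^ 2 := by positivity
    nlinarith [sq_nonneg (σ n)]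
  have hk1 : ∀ n, stepSize γ m p n ^ 2 * (2 * (C + |B n|) ^ 2 + 2 * σ n ^ 2)
      ≤ (4 * C ^ 2 + 4) * (stepSize γ m p n ^ 2 * (1 + B n ^ 2 + σ n ^ 2)) := fun n => by
    refine (mul_le_mul_of_nonneg_left (hQle n) (sq_nonneg _)).trans (le_of_eq ?_)
    ring
  have hpos1 : ∀ n, 0 ≤ stepSize γ m p n * |B n| := fun n => mul_nonneg (hc0 n) (abs_nonneg _)
  have hpos2 : ∀ n, 0 ≤ stepSize γ m p n ^ 2 * (1 + B n ^ 2 + σ n ^ 2) := fun n => by positivity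
  have hdrift_le : ∀ n, 2 * stepSize γ m p n * |B n| * D
      + stepSize γ m p n ^ 2 * (2 * (C + |B n|) ^ 2 + 2 * σ n ^ 2)
      ≤ k * stepError γ m p B σ n := fun n => by
    have e1 : 2 * stepSize γ m p n * |B n| * D ≤ k * (stepSize γ m p n * |B n|) := by
      rw [show 2 * stepSize γ m p n * |B n| * D = 2 * D * (stepSize γ m p n * |B n|) by ring]
      refine mul_le_mul_of_nonneg_right ?_ (hpos1 n)
      have hC1 : 1 ≤ 4 * C ^ 2 + 4 := by nlinarith [sq_nonneg C]
      have hD1 : 2 * D ≤ 1 + 2 * D + 4 * D ^ 2 := by nlinarith [sq_nonneg D]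
      rw [hk]
      exact hD1.trans (le_mul_of_one_le_right (by positivity) hC1)
    have e2 := hk1 n
    have e3 : (4 * C ^ 2 + 4) * (stepSize γ m p n ^ 2 * (1 + B n ^ 2 + σ n ^ 2))
        ≤ k * (stepSize γ m p n ^ 2 * (1 + B n ^ 2 + σ n ^ 2)) := by
      refine mul_le_mul_of_nonneg_right ?_ (hpos2 n)
      rw [hk]
      exact le_mul_of_one_le_left (by positivity) (by nlinarith [sq_nonneg D])
    unfold stepError
    linarith
  have hvar_le : ∀ n, 4 * D ^ 2 * stepSize γ m p n ^ 2 * (2 * (C + |B n|) ^ 2 + 2 * σ n ^ 2)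
      ≤ k * stepError γ m p B σ n := fun n => by
    have e1 := mul_le_mul_of_nonneg_left (hk1 n) (by positivity : 0 ≤ 4 * D ^ 2)
    have e2 : 4 * D ^ 2 * ((4 * C ^ 2 + 4) * (stepSize γ m p n ^ 2 * (1 + B n ^ 2 + σ n ^ 2)))
        ≤ k * (stepSize γ m p n ^ 2 * (1 + B n ^ 2 + σ n ^ 2)) := by
      rw [← mul_assoc, hk]
      refine mul_le_mul_of_nonneg_right (mul_le_mul_of_nonneg_right ?_ (by positivity)) (hpos2 n)
      linarith
    have e3 : 0 ≤ k * (stepSize γ m p n * |B n|) := mul_nonneg (by rw [hk]; positivity) (hpos1 n)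
    unfold stepError
    linarith
  have hk0 : 0 ≤ k := by rw [hk]; positivity
  have herr0 : ∀ n, 0 ≤ k * stepError γ m p B σ (n + 1) := fun n =>
    mul_nonneg hk0 (stepError_nonneg hγ.le hm _)
  rw [← tsum_mul_left] at hsumr ⊢
  refine measureReal_diff_le_of_drift (historyFiltration h.measurable) (C := D ^ 2)
    (W := fun n ω => ‖X (n + 1) ω - x‖ ^ 2)
    (h := fun n ω => 2 * stepSize γ m p (n + 1) *
          -⟪G.gradField (X (n + 1) ω), X (n + 1) ω - x⟫)
    ?_ (fun n => ((hXm n).sub stronglyMeasurable_const).norm.pow 2) (fun n ω => sq_nonneg _)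
    (fun n ω => pow_le_pow_left₀ (norm_nonneg _) (hD _ (hXK n ω)) 2) ?_ ?_ ?_ herr0
    (hsum.mul_left k) hsumr herr0 (hsum.mul_left k) (by positivity) ?_
  · exact measurable_history X (k := 1) (n := 1) ⟨le_rfl, le_rfl⟩ hU
  · intro n ω hω
    have := hstable _ (hXK n ω) (le_of_sq_le_sq hω hr.le)
    exact mul_nonneg (mul_nonneg zero_le_two (hc0 _)) (neg_nonneg.2 this)
  · intro n
    filter_upwards [ae_condExp_norm_sub_sq_le convex_policySet hx (hXm n) (hX0 (n + 1)) (hle n)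
      (hXK n) hD (hc0 (n + 1)) (h.memLp (n + 1) n.succ_pos) (hup n) (hbias n) (hQ n)] with ω hω _
    refine hω.trans ?_
    linarith [hdrift_le (n + 1)]
  · intro n
    filter_upwards [ae_condExp_sq_norm_sub_sq_le convex_policySet (hX0 n) (hX0 (n + 1))
      (hXK n) hD (h.memLp (n + 1) n.succ_pos) (hup n) (hQ n)] with ω hω
    exact hω.trans (hvar_le (n + 1))
  · intro ω hω
    have := pow_le_pow_left₀ (norm_nonneg _) (hUr _ hω) 2
    linarith

end StochasticGame

theorem mainTheorem1 {ι : Type u} {S : Type v} {A : ι → Type w}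
    [Fintype ι] [DecidableEq ι] [Fintype S] [∀ i, Fintype (A i)]
    (G : StochasticGame ι S A) (x : ProfileSpace ι S A) (hx : G.IsStableNash x) :
    ∃ U : Set (ProfileSpace ι S A),
      U ⊆ policySet ι S A ∧ MeasurableSet U ∧ U ∈ 𝓝[policySet ι S A] x ∧
      ∀ (p lb ls : ℝ) (B σ : ℕ → ℝ),
        1 / 2 < p → p ≤ 1 → 1 < p + lb → 1 / 2 < p - ls →
        B =O[atTop] (fun n : ℕ => (n : ℝ) ^ (-lb)) →
        σ =O[atTop] (fun n : ℕ => (n : ℝ) ^ ls) →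
        ∀ δ : ℝ, 0 < δ →
          (∃ γ₀ : ℝ, 0 < γ₀ ∧ ∀ γ m : ℝ, 0 < γ → γ ≤ γ₀ → 0 ≤ m →
            StochasticGame.LocallyConvergent.{u, v, w, z} G x U δ γ m p B σ) ∧
          (∀ γ : ℝ, 0 < γ → ∃ m₀ : ℝ, 0 ≤ m₀ ∧ ∀ m : ℝ, m₀ ≤ m →
            StochasticGame.LocallyConvergent.{u, v, w, z} G x U δ γ m p B σ) := by
  have hxK : x ∈ policySet ι S A := hx.1.1
  have hcpt := isCompact_policySet (ι := ι) (S := S) (A := A)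
  obtain ⟨r, hr, hball⟩ := (nhdsWithin_hasBasis Metric.nhds_basis_closedBall _).eventually_iff.1 hx.2
  have hneg : ∀ y ∈ policySet ι S A, ‖y - x‖ ≤ r → y ≠ x → ⟪G.gradField y, y - x⟫ < 0 :=
    fun y hy hyr hyx => hball ⟨mem_closedBall_iff_norm.2 hyr, hy, hyx⟩
  have hstable : ∀ y ∈ policySet ι S A, ‖y - x‖ ≤ r → ⟪G.gradField y, y - x⟫ ≤ 0 := by
    intro y hy hyr
    rcases eq_or_ne y x with rfl | hne
    · simp
    · exact (hneg y hy hyr hne).le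
  obtain ⟨C, hC⟩ := hcpt.exists_bound_of_continuousOn G.continuousOn_gradField
  obtain ⟨D, hD⟩ := hcpt.exists_bound_of_continuousOn
    (f := fun y : ProfileSpace ι S A => y - x) (by fun_prop)
  have hD0 : 0 ≤ D := (norm_nonneg _).trans (hD x hxK)
  set U := policySet ι S A ∩ Metric.closedBall x (r / 2) with hU
  have hUmeas : MeasurableSet U := hcpt.isClosed.measurableSet.inter measurableSet_closedBall
  -- `U` depends on the radius of stability only, so that it serves all parameters at once.
  refine ⟨U, Set.inter_subset_left, hUmeas, inter_mem self_mem_nhdsWithin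
    (mem_nhdsWithin_of_mem_nhds (Metric.closedBall_mem_nhds x (by positivity))), ?_⟩
  intro p lb ls B σ hp hp1 hlb hls hB hσ δ hδ
  set k := (1 + 2 * D + 4 * D ^ 2) * (4 * C ^ 2 + 4) with hk
  have hkpos : 0 < k := by positivity
  -- `η` makes `k η ≤ r ^ 2 / 4`, and the exceptional relative probability `4 k η / r ^ 4 ≤ δ`.
  set η := min (r ^ 2 / 4) (δ * (r ^ 2) ^ 2 / 4) / k with hη
  have hηpos : 0 < η := by positivity
  have hkη : k * η = min (r ^ 2 / 4) (δ * (r ^ 2) ^ 2 / 4) := by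
    rw [hη]; field_simp
  obtain ⟨hsum, hsmall, hlarge⟩ := summable_and_tsum_stepError_le hp hlb hls hB hσ hηpos
  have main : ∀ γ m : ℝ, 0 < γ → 0 ≤ m → ∑' n, stepError γ m p B σ (n + 1) ≤ η →
      StochasticGame.LocallyConvergent.{u, v, w, z} G x U δ γ m p B σ := by
    intro γ m hγ hm hle Ω _ μ _ X Y h hpos
    have hkle := mul_le_mul_of_nonneg_left hle hkpos.le
    rw [hkη] at hkle
    have hbound := h.measureReal_diff_le hγ hm hxK hr hstable hC hD0 hD hk (hsum γ m hγ hm)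
      (hkle.trans (min_le_left _ _)) hUmeas fun y hy => mem_closedBall_iff_norm.1 hy.2
    set a := {ω | X 1 ω ∈ U} with ha
    set T := {ω | Tendsto (fun n => X n ω) atTop (𝓝 x)} with hT
    have hgood : a \ T ⊆ a \ {ω | (∀ n, ‖X (n + 1) ω - x‖ ^ 2 ≤ r ^ 2) ∧
        (∃ l, Tendsto (fun n => ‖X (n + 1) ω - x‖ ^ 2) atTop (𝓝 l)) ∧
        Summable fun n => 2 * stepSize γ m p (n + 1) *
          -⟪G.gradField (X (n + 1) ω), X (n + 1) ω - x⟫} := by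
      refine Set.sdiff_subset_sdiff_right ?_
      rintro ω ⟨hstay, ⟨l, hl⟩, hs⟩
      refine (tendsto_add_atTop_iff_nat (f := fun n => X n ω) 1).1 ?_
      refine tendsto_of_summable_mul (hcpt.inter_right (Metric.isClosed_closedBall (x := x) (ε := r)))
        (φ := fun y => -⟪G.gradField y, y - x⟫) ?_ ?_ (fun n => ⟨h.mem_policySet n.succ_pos ω,
          mem_closedBall_iff_norm.2 (le_of_sq_le_sq (hstay n) hr.le)⟩)
        (c := fun n => 2 * stepSize γ m p (n + 1))
        (fun n => mul_nonneg zero_le_two (stepSize_nonneg hγ.le hm _)) ?_ hs hl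
      · exact ((G.continuousOn_gradField.inner (continuousOn_id.sub continuousOn_const)).neg).mono Set.inter_subset_left
      · exact fun y hy hne => neg_pos.2 (hneg y hy.1 (mem_closedBall_iff_norm.1 hy.2) hne)
      · rw [summable_mul_left_iff two_ne_zero]
        exact not_summable_stepSize hγ hm hp1
    have hameas : MeasurableSet a := h.measurable 1 le_rfl hUmeas
    have hδ' : μ.real (a \ T) ≤ δ * μ.real a := by
      refine (measureReal_mono hgood).trans (hbound.trans ?_)
      refine mul_le_mul_of_nonneg_right ?_ measureReal_nonneg
      rw [div_le_iff₀ (by positivity)]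
      linarith [hkle.trans (min_le_right _ _)]
    have hapos : 0 < μ.real a := ENNReal.toReal_pos hpos (measure_ne_top _ _)
    have hinter : (1 - δ) * μ.real a ≤ μ.real (a ∩ T) := by
      have hcover : μ.real a ≤ μ.real (a ∩ T) + μ.real (a \ T) := by
        refine (measureReal_mono ?_).trans (measureReal_union_le _ _)
        rw [Set.inter_union_sdiff]
      linarith
    refine ENNReal.ofReal_le_of_le_toReal ?_
    change 1 - δ ≤ (μ[|a]).real T
    rw [measureReal_def, cond_apply hameas, ENNReal.toReal_mul, ENNReal.toReal_inv,
      ← measureReal_def, ← measureReal_def, ← div_eq_inv_mul, le_div_iff₀ hapos]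
    exact hinter
  refine ⟨?_, fun γ hγ => ?_⟩
  · obtain ⟨γ₀, hγ₀, hle⟩ := hsmall
    exact ⟨γ₀, hγ₀, fun γ m hγ hγle hm => main γ m hγ hm (hle γ m hγ hγle hm)⟩
  · obtain ⟨m₀, hm₀, hle⟩ := hlarge γ hγ
    exact ⟨m₀, hm₀, fun m hm => main γ m hγ (hm₀.trans hm) (hle m hm)⟩
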